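/- For $|p|<1$ let $(a;p)_\infty=\prod_{n\ge 0}(1-ap^n)$, $\theta(z;p)=(z;p)_\infty(pz^{-1};p)_\infty$ and $\theta(t;p;q)_n=\prod_{m=0}^{n-1}\theta(tq^m;p)$. Let $\{x\}$ denote the fractional part of $x$, and for irrational $\chi$ let $q_k(\chi)$ denote the denominator of the $k$-th convergent of the continued fraction of $\chi$. Say that an irrational $\chi$ satisfies the Hardy--Littlewood condition if $$\limsup_{k\to\infty}\frac{\log q_{k+1}(\chi)}{q_k(\chi)}=0. \qquad (\ast)$$ Theorem. Almost every real number $\chi$ (with respect to Lebesgue measure) is irrational and satisfies $(\ast)$. Moreover, let $\operatorname{Im}\tau>0$, $p=e^{2\pi i\tau}$, let $N,M$ be coprime integers, let $\chi$ be any irrational number satisfying $(\ast)$, and let $q=e^{2\pi i\chi(N+M\tau)}$. Let $r\ge 0$ and let $t_0,\dots,t_r,w_1,\dots,w_r$ be nonzero complex numbers with $\prod_{k=0}^r t_k=q\prod_{k=1}^r w_k$, such that none of the $t_j$ $(0\le j\le r)$ and $w_j$ $(1\le j\le r)$ is of the form $p^k e^{2\pi i x(N+M\tau)}$ with $k\in\mathbb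 Z$, $x\in\mathbb R$ (in particular $t_0\ne q$). Let $$c_n=\frac{\theta(t_0;p;q)_n\cdots\theta(t_r;p;q)_n}{\theta(q;p;q)_n\,\theta(w_1;p;q)_n\cdots\theta(w_r;p;q)_n},\qquad n\ge 0 .$$ Then the limit $\lim_{n\to\infty}|c_n|^{1/n}$ exists and equals $r_c^{-1}$, and the power series ${}_{r+1}E_r=\sum_{n\ge 0}c_nz^n$ has radius of convergence $r_c$, where, with $w_0:=q$, $$\log r_c^{-1}=\sum_{k=0}^r\left(\frac{\log^2|t_k|-\log^2|w_k|}{4\pi\operatorname{Im}\tau}+\frac{\pi\operatorname{Im}\tau}{|N+M\tau|^2}\bigl(\alpha_k(\alpha_k-1)-\beta_k(\beta_k-1)\bigr)\right),$$ $$\alpha_k=\left\{\frac{\operatorname{Re}\bigl((N+M\tau)\log\bar w_k\bigr)}{2\pi\operatorname{Im}\tau}\right\},\qquad \beta_k=\left\{\frac{\operatorname{Re}\bigl((N+M\tau)\log\bar t_k\bigr)}{2\pi\operatorname{Im}\tau}\right\}.$$ (These numbers do not depend on the choice of the branch of $\log$.) -/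

import Mathlib

open Filter Topology MeasureTheory

noncomputable section

namespace EllipticHypergeometric

/-- The infinite Pochhammer symbol `(a; p)_∞ = ∏_{n ≥ 0} (1 - a pⁿ)`, for `|p| < 1`. -/
def pochInf (a p : ℂ) : ℂ := ∏' n : ℕ, (1 - a * p ^ n)

/-- The theta function `θ(z; p) = (z; p)_∞ (p z⁻¹; p)_∞`. -/
def theta (z p : ℂ) : ℂ := pochInf z p * pochInf (p * z⁻¹) p

/-- The elliptic Pochhammer symbol `θ(t; p; q)_n = ∏_{m < n} θ(t q^m; p)`. -/
def thetaPoch (t p q : ℂ) (n : ℕ) : ℂ := ∏ m ∈ Finset.range n, theta (t * q ^ m) p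

/-- The coefficient of `zⁿ` in the theta hypergeometric series `_sE_r(t; w; q, p | z)`:
`θ(t_0, …, t_{s-1}; p; q)_n / θ(q, w_1, …, w_r; p; q)_n`. -/
def coeffE {s r : ℕ} (t : Fin s → ℂ) (w : Fin r → ℂ) (q p : ℂ) (n : ℕ) : ℂ :=
  (∏ j, thetaPoch (t j) p q n) / (thetaPoch q p q n * ∏ k, thetaPoch (w k) p q n)

/-- The power series `_sE_r(t; w; q, p | z)` in the variable `z`. -/
def seriesE {s r : ℕ} (t : Fin s → ℂ) (w : Fin r → ℂ) (q p : ℂ) :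
    FormalMultilinearSeries ℂ ℂ ℂ :=
  FormalMultilinearSeries.ofScalars ℂ (coeffE t w q p)

/-- `p = e^{2πiτ}`. -/
def nome (τ : ℂ) : ℂ := Complex.exp (2 * Real.pi * Complex.I * τ)

/-- The point `e^{2πi x (N + M τ)}`, `x` real. For `x = χ` this is the base `q`; as `x` runs over
`ℝ` it runs over `q^ℝ`. -/
def linePoint (N M : ℤ) (τ : ℂ) (x : ℝ) : ℂ :=
  Complex.exp (2 * Real.pi * Complex.I * x * (N + M * τ))

/-- `u` does not lie on the image of the line `x ↦ e^{2πi x (N + M τ)}` on the elliptic curve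
`ℂˣ / p^ℤ`. -/
def OffLine (N M : ℤ) (τ u : ℂ) : Prop :=
  ∀ (k : ℤ) (x : ℝ), u ≠ nome τ ^ k * linePoint N M τ x

/-- The denominator `q_k` of the `k`-th convergent of the continued fraction of `χ`. -/
def cfDen (χ : ℝ) (k : ℕ) : ℝ := (GenContFract.of χ).dens k

/-- `limsup_k log q_{k+1} / q_k = 0`, the upper limit being taken in `[-∞, ∞]`. -/
def HardyLittlewood (χ : ℝ) : Prop :=
  limsup (fun k : ℕ => ((Real.log (cfDen χ (k + 1)) / cfDen χ k : ℝ) : EReal)) atTop = 0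

/-- The fractional part `{ Re((N + M τ) log ū) / (2π Im τ) }`. It does not depend on the branch of
the logarithm: another branch changes the argument of `Int.fract` by an integer multiple of `M`. -/
def phase (N M : ℤ) (τ u : ℂ) : ℝ :=
  Int.fract ((((N : ℂ) + M * τ) * Complex.log (starRingEnd ℂ u)).re / (2 * Real.pi * τ.im))

/-- The right-hand side of the formula for `log r_c⁻¹`, for parameters `t_0, …, t_r` and
`w_0, …, w_r`. -/
def logInvRadius {n : ℕ} (N M : ℤ) (τ : ℂ) (t w : Fin n → ℂ) : ℝ :=
  ∑ k, ((Real.log ‖t k‖ ^ 2 - Real.log ‖w k‖ ^ 2) / (4 * Real.pi * τ.im)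
    + Real.pi * τ.im / ‖(N : ℂ) + M * τ‖ ^ 2 *
      (phase N M τ (w k) * (phase N M τ (w k) - 1)
        - phase N M τ (t k) * (phase N M τ (t k) - 1)))

end EllipticHypergeometric

end

namespace EllipticHypergeometric

/-! ### Convergents of an irrational number -/

/-! Write ω = N + Mτ. The logarithm of |θ(u; p; q)_n| is a sum of log|θ(u q^m; p)|, and in additive
coordinates u q^m is the point v + mχω. Multiplying |θ| by a Gaussian factor gives `thetaNorm`,
which is periodic for the lattice ℤ + ℤτ. The removed factors grow quadratically in m, but the
balancing condition cancels their dependence on m and leaves only the log²|t_k| - log²|w_k| terms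
(`sum_growth_sub`).

It remains to average log `thetaNorm` along an irrational rotation of the closed curve v + ℝω. If u
is off the line, this function is continuous on the curve, and Weyl's theorem gives its mean. That
mean depends only on the fractional part β of the coordinate transversal to ω. Integrating the
quasi-periodicity of θ'/θ twice shows that it is quadratic in β, and evenness of `thetaNorm` fixes
the linear term: the mean is c₀ - (π Im τ/|ω|²) β(β - 1) (`exists_meanLog_eq`). The constant c₀
cancels, as numerator and denominator have equally many factors.

For u = q the curve passes through the zero of θ, and Weyl's theorem does not apply. The orbit is
compared with one on a nearby parallel line. The error is a sum of truncated logarithms of the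
distances from (m+1)χ to ℤ, which the Hardy–Littlewood condition makes small on average
(`eventually_sum_truncLog_le`). The limit is c₀, the formula at β = 0. The root test concludes. -/

lemma exists_int_contsAux (χ : ℝ) (n : ℕ) :
    ∃ a b : ℤ, (GenContFract.of χ).contsAux n = ⟨(a : ℝ), (b : ℝ)⟩ := by
  induction n using Nat.strong_induction_on with
  | _ n ih =>
    match n with
    | 0 => exact ⟨1, 0, by simp⟩
    | 1 => exact ⟨⌊χ⌋, 1, by simp⟩
    | n + 2 =>
      obtain ⟨a, b, h0⟩ := ih n (by omega)
      obtain ⟨a', b', h1⟩ := ih (n + 1) (by omega)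
      rcases hs : (GenContFract.of χ).s.get? n with _ | gp
      · exact ⟨a', b', by rw [GenContFract.contsAux_stable_step_of_terminated hs, h1]⟩
      · obtain ⟨ha, z, hz⟩ := GenContFract.of_partNum_eq_one_and_exists_int_partDen_eq hs
        refine ⟨z * a' + a, z * b' + b, ?_⟩
        rw [GenContFract.contsAux_recurrence hs h0 h1, ha, hz]
        push_cast
        simp

lemma not_terminatedAt_of_irrational {χ : ℝ} (hχ : Irrational χ) (n : ℕ) :
    ¬ (GenContFract.of χ).TerminatedAt n := by
  intro h
  obtain ⟨q, hq⟩ := (GenContFract.terminates_iff_rat χ).1 ⟨n, h⟩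
  exact hχ ⟨q, hq.symm⟩

/-- The convergents of an irrational number, as a sequence of reduced fractions. -/
lemma exists_convergents {χ : ℝ} (hχ : Irrational χ) :
    ∃ (a : ℕ → ℤ) (Q : ℕ → ℕ), (∀ k, cfDen χ k = Q k) ∧ (∀ k, 0 < Q k) ∧
      (∀ k, IsCoprime (a k) (Q k : ℤ)) ∧ Monotone Q ∧ Tendsto Q atTop atTop ∧
      ∀ k, |χ - a k / Q k| ≤ 1 / ((Q k : ℝ) * Q (k + 1)) := by
  have hnt := not_terminatedAt_of_irrational hχ
  choose a b hab using fun k => exists_int_contsAux χ (k + 1)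
  have hnum : ∀ k, (GenContFract.of χ).nums k = a k := fun k => by
    rw [GenContFract.num_eq_conts_a, GenContFract.nth_cont_eq_succ_nth_contAux, hab]
  have hden : ∀ k, (GenContFract.of χ).dens k = b k := fun k => by
    rw [GenContFract.den_eq_conts_b, GenContFract.nth_cont_eq_succ_nth_contAux, hab]
  -- Fibonacci growth yields both the positivity of the denominators and their divergence.
  have hfib : ∀ k, (Nat.fib (k + 1) : ℝ) ≤ b k := fun k => by
    rw [← hden]; exact GenContFract.succ_nth_fib_le_of_nth_den (Or.inr (hnt _))
  have hfib' : ∀ k, (Nat.fib (k + 1) : ℤ) ≤ b k := fun k => by exact_mod_cast hfib k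
  have hb : ∀ k, ((b k).toNat : ℤ) = b k := fun k =>
    Int.toNat_of_nonneg (le_trans (by positivity) (hfib' k))
  have hbR : ∀ k, (((b k).toNat : ℕ) : ℝ) = b k := fun k => by exact_mod_cast hb k
  have hle : ∀ k, Nat.fib (k + 1) ≤ (b k).toNat := fun k => by
    have := hfib' k; rw [← hb k] at this; exact_mod_cast this
  refine ⟨a, fun k => (b k).toNat, fun k => ?_, fun k => ?_, fun k => ?_, ?_, ?_, fun k => ?_⟩
  · rw [cfDen, hden, hbR]
  · exact lt_of_lt_of_le (Nat.fib_pos.2 k.succ_pos) (hle k)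
  · have hdet := (SimpContFract.of χ).determinant (n := k)
    have hdet' : (a k : ℝ) * b (k + 1) - b k * a (k + 1) = (-1) ^ (k + 1) := by
      rw [← hnum, ← hnum, ← hden, ← hden]; exact hdet (hnt k)
    have hdz : a k * b (k + 1) - b k * a (k + 1) = (-1) ^ (k + 1) := by exact_mod_cast hdet'
    rw [hb]
    -- The determinant identity, multiplied by its sign, is a Bézout relation.
    refine ⟨(-1) ^ (k + 1) * b (k + 1), (-1) ^ (k + 1) * (-a (k + 1)), ?_⟩
    have h1 : ((-1 : ℤ) ^ (k + 1)) * (-1) ^ (k + 1) = 1 := by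
      rw [← mul_pow]; simp
    linear_combination (-1) ^ (k + 1) * hdz + h1
  · refine monotone_nat_of_le_succ fun k => ?_
    have : (GenContFract.of χ).dens k ≤ (GenContFract.of χ).dens (k + 1) :=
      GenContFract.of_den_mono
    rw [hden, hden, ← hbR, ← hbR] at this
    exact_mod_cast this
  · refine tendsto_atTop.2 fun c => ?_
    filter_upwards [eventually_ge_atTop (c + 1)] with k hk
    have h1 := Nat.le_fib_add_one k
    have h2 := (Nat.fib_mono k.le_succ).trans (hle k)
    omega
  · have := GenContFract.abs_sub_convs_le (v := χ) (hnt k)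
    rwa [GenContFract.convs, hden, hden, hnum, ← hbR, ← hbR] at this

/-- Almost no χ is Liouville with exponent 3 (any exponent above 2 would serve). Against the error
bound 1/(Q_k Q_{k+1}) this forces Q_{k+1} ≤ Q_k² eventually, so the quotient is at most 2 log Q_k /
Q_k. -/
lemma ae_irrational_hardyLittlewood :
    ∀ᵐ χ : ℝ, Irrational χ ∧ HardyLittlewood χ := by
  have hirr : ∀ᵐ χ : ℝ, Irrational χ := (Set.countable_range _).ae_notMem volume
  filter_upwards [hirr, ae_not_liouvilleWith] with χ hχ hL
  refine ⟨hχ, ?_⟩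
  obtain ⟨a, Q, hQ, hpos, -, hmono, htend, happ⟩ := exists_convergents hχ
  have hL3 := hL 3 (by norm_num)
  simp only [LiouvilleWith, not_exists, not_frequently] at hL3
  have hev : ∀ᶠ k in atTop, (Q (k + 1) : ℝ) ≤ (Q k : ℝ) ^ 2 := by
    filter_upwards [htend.eventually (hL3 1)] with k hk
    have h1 := hk (a k)
    have hq : (0 : ℝ) < Q k := by exact_mod_cast hpos k
    have hq' : (0 : ℝ) < Q (k + 1) := by exact_mod_cast hpos (k + 1)
    have hne : χ ≠ a k / Q k := by
      intro h
      exact hχ ⟨(a k : ℚ) / (Q k : ℚ), by push_cast; exact h.symm⟩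
    have h2 : 1 / (Q k : ℝ) ^ (3 : ℝ) ≤ |χ - a k / Q k| := not_lt.1 fun h => h1 ⟨hne, h⟩
    have h3 := h2.trans (happ k)
    have h4 : (Q k : ℝ) ^ (3 : ℝ) = (Q k : ℝ) ^ 3 := by norm_cast
    rw [h4, one_div_le_one_div (by positivity) (by positivity)] at h3
    have : (Q k : ℝ) * Q (k + 1) ≤ Q k * (Q k : ℝ) ^ 2 := by linarith [h3, pow_succ (Q k : ℝ) 2]
    exact le_of_mul_le_mul_left this hq
  have htR : Tendsto (fun k => (Q k : ℝ)) atTop atTop :=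
    tendsto_natCast_atTop_atTop.comp htend
  have hlog : Tendsto (fun k => 2 * (Real.log (Q k) / Q k)) atTop (𝓝 0) := by
    have := (Real.isLittleO_log_id_atTop.tendsto_div_nhds_zero.comp htR).const_mul 2
    simpa using this
  have hmain : Tendsto (fun k => Real.log (cfDen χ (k + 1)) / cfDen χ k) atTop (𝓝 0) := by
    refine tendsto_of_tendsto_of_tendsto_of_le_of_le' tendsto_const_nhds hlog ?_ ?_
    · refine Eventually.of_forall fun k => ?_
      rw [hQ, hQ]
      exact div_nonneg (Real.log_natCast_nonneg _) (Nat.cast_nonneg _)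
    · filter_upwards [hev] with k hk
      have hq' : (0 : ℝ) < Q (k + 1) := by exact_mod_cast hpos (k + 1)
      have h5 := Real.log_le_log hq' hk
      rw [Real.log_pow] at h5
      rw [hQ, hQ, ← mul_div_assoc]
      gcongr
      exact_mod_cast h5
  have h6 := (continuous_coe_real_ereal.tendsto 0).comp hmain
  exact h6.limsup_eq

lemma HardyLittlewood.eventually_log_le {χ : ℝ} (h : HardyLittlewood χ) {Q : ℕ → ℕ}
    (hQ : ∀ k, cfDen χ k = Q k) (hpos : ∀ k, 0 < Q k) {ε : ℝ} (hε : 0 < ε) :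
    ∀ᶠ k in atTop, Real.log (Q (k + 1)) ≤ ε * Q k := by
  have h1 : limsup (fun k : ℕ => ((Real.log (cfDen χ (k + 1)) / cfDen χ k : ℝ) : EReal)) atTop
      < (ε : EReal) := by
    rw [show limsup _ _ = (0 : EReal) from h]; exact_mod_cast hε
  filter_upwards [eventually_lt_of_limsup_lt h1] with k hk
  have hq : (0 : ℝ) < Q k := by exact_mod_cast hpos k
  rw [EReal.coe_lt_coe_iff, hQ, hQ, div_lt_iff₀ hq] at hk
  exact hk.le

/-- Since a/Q is reduced and 0 < j < Q, the number ja/Q is at distance at least 1/Q from every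
integer. Replacing a/Q by χ moves it by at most j/(QQ') ≤ 1/(2Q). -/
lemma le_abs_mul_sub_int {χ : ℝ} {a : ℤ} {Q Q' : ℕ} (hQ : 0 < Q) (hQQ' : Q ≤ Q')
    (hc : IsCoprime a (Q : ℤ)) (happ : |χ - a / Q| ≤ 1 / ((Q : ℝ) * Q')) {j : ℕ} (hj : 0 < j)
    (hjQ : 2 * j ≤ Q) (b : ℤ) : 1 / (2 * (Q : ℝ)) ≤ |j * χ - b| := by
  have hq : (0 : ℝ) < Q := by exact_mod_cast hQ
  have hq' : (Q : ℝ) ≤ Q' := by exact_mod_cast hQQ'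
  have hq'' : (0 : ℝ) < Q' := hq.trans_le hq'
  have hjq : 2 * (j : ℝ) ≤ Q := by exact_mod_cast hjQ
  have hne : (j : ℤ) * a - b * Q ≠ 0 := by
    intro h
    have hdvd : (Q : ℤ) ∣ (j : ℤ) * a := ⟨b, by linarith [mul_comm b (Q : ℤ)]⟩
    have h2 := Int.le_of_dvd (by exact_mod_cast hj) (hc.symm.dvd_of_dvd_mul_right hdvd)
    have : Q ≤ j := by exact_mod_cast h2
    omega
  have h1 : (1 : ℝ) ≤ |(j : ℝ) * a - b * Q| := by exact_mod_cast Int.one_le_abs hne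
  have h2 : 1 / (Q : ℝ) ≤ |(j : ℝ) * (a / Q) - b| := by
    have : (j : ℝ) * (a / Q) - b = (j * a - b * Q) / Q := by field_simp
    rw [this, abs_div, abs_of_pos hq]
    gcongr
  have h3 : |(j : ℝ) * (χ - a / Q)| ≤ 1 / (2 * (Q : ℝ)) := by
    rw [abs_mul, Nat.abs_cast]
    calc (j : ℝ) * |χ - a / Q| ≤ j * (1 / ((Q : ℝ) * Q')) := by gcongr
      _ ≤ (Q / 2) * (1 / ((Q : ℝ) * Q)) := by gcongr; linarith
      _ = 1 / (2 * (Q : ℝ)) := by field_simp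
  have h4 : 1 / (Q : ℝ) = 1 / (2 * (Q : ℝ)) + 1 / (2 * (Q : ℝ)) := by field_simp; norm_num
  have h5 : (j : ℝ) * (a / Q) - b = (j * χ - b) - j * (χ - a / Q) := by ring
  have h6 := abs_sub (j * χ - b) (j * (χ - a / Q))
  rw [← h5] at h6
  linarith

/-! ### Sums of truncated logarithms over separated points -/

/-- Only the terms with j + 1 ≤ s can be positive. L of them add up to log(s^L / L!), and s^L / L! ≤
e^s. -/
lemma sum_max_log_div_le (s : ℝ) (hs : 0 ≤ s) (K : ℕ) :
    ∑ j ∈ Finset.range K, max 0 (Real.log (s / (j + 1 : ℕ))) ≤ s := by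
  induction K with
  | zero => simpa
  | succ K ih =>
    by_cases hK : ((K + 1 : ℕ) : ℝ) ≤ s
    · have hs' : 0 < s := lt_of_lt_of_le (by positivity) hK
      have h1 : ∀ L : ℕ, L ≤ K + 1 →
          ∑ j ∈ Finset.range L, max 0 (Real.log (s / (j + 1 : ℕ))) =
            Real.log (s ^ L / L.factorial) := by
        intro L
        induction L with
        | zero => simp
        | succ L ihL =>
          intro hL
          have hLs : ((L + 1 : ℕ) : ℝ) ≤ s := le_trans (by exact_mod_cast hL) hK
          rw [Finset.sum_range_succ, ihL (by omega), max_eq_right, ← Real.log_mul]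
          · congr 1
            rw [Nat.factorial_succ]
            push_cast
            field_simp
            ring
          · positivity
          · positivity
          · apply Real.log_nonneg
            rw [one_le_div (by positivity)]
            exact hLs
      rw [h1 _ le_rfl, Real.log_le_iff_le_exp (by positivity)]
      exact Real.pow_div_factorial_le_exp _ hs _
    · rw [Finset.sum_range_succ, max_eq_left, add_zero]
      · exact ih
      · apply Real.log_nonpos (by positivity)
        rw [div_le_one (by positivity)]
        exact (not_le.1 hK).le

/-- Cut each half-line into cells of length d: by separation each cell holds at most one point. Cell
0 is controlled by δ; cell k ≥ 1 costs at most log⁺(η/(dk)), and these sum to at most η/d. The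
factor 2 counts the two signs. -/
lemma sum_truncLog_le_of_separated {ι : Type*} (B : Finset ι) (y : ι → ℝ) {d δ η : ℝ}
    (hd : 0 < d) (hδ : 0 < δ) (hη : 0 < η) (hsep : ∀ i ∈ B, ∀ j ∈ B, i ≠ j → d ≤ |y i - y j|)
    (hmin : ∀ i ∈ B, δ ≤ |y i|) :
    ∑ i ∈ B, max 0 (Real.log (η / |y i|)) ≤ 2 * max 0 (Real.log (η / δ)) + 2 * (η / d) := by
  classical
  set ψ : ℕ → ℝ := fun k => if k = 0 then max 0 (Real.log (η / δ)) else
    max 0 (Real.log (η / d / k)) with hψ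
  have hψ0 : ∀ k, 0 ≤ ψ k := fun k => by
    simp only [hψ]; split_ifs <;> exact le_max_left _ _
  set g : ι → Bool × ℕ := fun i => (decide (0 ≤ y i), ⌊|y i| / d⌋₊) with hg
  have hinj : Set.InjOn g B := by
    intro i hi j hj hij
    by_contra hne
    have h1 := hsep i hi j hj hne
    simp only [hg, Prod.mk.injEq, decide_eq_decide] at hij
    obtain ⟨hs, hf⟩ := hij
    have a1 := Nat.floor_le (div_nonneg (abs_nonneg (y i)) hd.le)
    have a2 := Nat.lt_floor_add_one (|y i| / d)
    have b1 := Nat.floor_le (div_nonneg (abs_nonneg (y j)) hd.le)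
    have b2 := Nat.lt_floor_add_one (|y j| / d)
    rw [hf] at a1 a2
    rw [le_div_iff₀ hd] at a1 b1
    rw [div_lt_iff₀ hd, add_mul, one_mul] at a2 b2
    generalize (⌊|y j| / d⌋₊ : ℝ) = fl at a1 a2 b1 b2
    have h2 : |y i - y j| < d := by
      by_cases h0 : 0 ≤ y i
      · rw [abs_of_nonneg h0] at a1 a2
        rw [abs_of_nonneg (hs.1 h0)] at b1 b2
        rw [abs_lt]; constructor <;> linarith
      · have h0' : ¬ 0 ≤ y j := fun h => h0 (hs.2 h)
        rw [abs_of_neg (not_le.1 h0)] at a1 a2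
        rw [abs_of_neg (not_le.1 h0')] at b1 b2
        rw [abs_lt]; constructor <;> linarith
    linarith
  have hterm : ∀ i ∈ B, max 0 (Real.log (η / |y i|)) ≤ ψ (g i).2 := by
    intro i hi
    have hyi := hmin i hi
    have hyp : 0 < |y i| := hδ.trans_le hyi
    simp only [hψ, hg]
    split_ifs with h0
    · gcongr
    · have hfl : 0 < (⌊|y i| / d⌋₊ : ℝ) := by exact_mod_cast Nat.pos_of_ne_zero h0
      have a1 := Nat.floor_le (div_nonneg (abs_nonneg (y i)) hd.le)
      rw [le_div_iff₀ hd] at a1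
      rw [div_div]
      gcongr
      linarith
  obtain ⟨K, hK⟩ : ∃ K, ∀ i ∈ B, (g i).2 < K + 1 := by
    refine ⟨B.sup fun i => (g i).2, fun i hi => Nat.lt_succ_of_le ?_⟩
    exact Finset.le_sup (f := fun i => (g i).2) hi
  calc ∑ i ∈ B, max 0 (Real.log (η / |y i|)) ≤ ∑ i ∈ B, ψ (g i).2 := Finset.sum_le_sum hterm
    _ = ∑ x ∈ B.image g, ψ x.2 := by rw [Finset.sum_image hinj]
    _ ≤ ∑ x ∈ (Finset.univ : Finset Bool) ×ˢ Finset.range (K + 1), ψ x.2 := by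
        apply Finset.sum_le_sum_of_subset_of_nonneg
        · intro x hx
          obtain ⟨i, hi, rfl⟩ := Finset.mem_image.1 hx
          simpa using hK i hi
        · intros; exact hψ0 _
    _ = 2 * ∑ k ∈ Finset.range (K + 1), ψ k := by
        rw [Finset.sum_product]; simp
    _ ≤ 2 * (max 0 (Real.log (η / δ)) + η / d) := by
        rw [Finset.sum_range_succ']
        have := sum_max_log_div_le (η / d) (by positivity) K
        simp only [hψ, Nat.succ_ne_zero, if_false, if_true]
        linarith
    _ = _ := by ring

/-- For `χ` satisfying the Hardy–Littlewood condition, multiples of `χ` close to integers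
contribute little to averages of logarithms. -/
lemma eventually_sum_truncLog_le {χ : ℝ} (hχ : Irrational χ) (hHL : HardyLittlewood χ) {η : ℝ}
    (hη : 0 < η) :
    ∀ᶠ n : ℕ in atTop, ∑ m ∈ Finset.range n,
      max 0 (Real.log (η / |((m + 1 : ℕ) : ℝ) * χ - round (((m + 1 : ℕ) : ℝ) * χ)|))
        ≤ 17 * η * n := by
  obtain ⟨a, Q, hQ, hpos, hcop, hmono, htend, happ⟩ := exists_convergents hχ
  have htR : Tendsto (fun k => (Q k : ℝ)) atTop atTop :=
    tendsto_natCast_atTop_atTop.comp htend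
  set y : ℕ → ℝ := fun m => ((m + 1 : ℕ) : ℝ) * χ - round (((m + 1 : ℕ) : ℝ) * χ) with hy
  -- The Hardy–Littlewood condition enters here: it bounds the cost of the closest return, whose
  -- distance to ℤ may be as small as 1/(2Q_{k+1}).
  have hev : ∀ᶠ k in atTop, max 0 (Real.log (η / (1 / (2 * (Q (k + 1) : ℝ))))) ≤ η / 8 * Q k := by
    filter_upwards [hHL.eventually_log_le hQ hpos (show 0 < η / 16 by positivity),
      htR.eventually_ge_atTop (|Real.log (2 * η)| / (η / 16))] with k h1 h2
    rw [div_le_iff₀ (by positivity)] at h2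
    have hq' : (0 : ℝ) < Q (k + 1) := by exact_mod_cast hpos (k + 1)
    apply max_le (by positivity)
    rw [show η / (1 / (2 * (Q (k + 1) : ℝ))) = 2 * η * Q (k + 1) by field_simp,
      Real.log_mul (by positivity) hq'.ne']
    linarith [le_abs_self (Real.log (2 * η))]
  obtain ⟨k₀, hk₀⟩ := eventually_atTop.1 hev
  filter_upwards [eventually_ge_atTop (Q k₀)] with n hn
  have hex : ∃ K, 2 * n < Q K := (htend.eventually_gt_atTop (2 * n)).exists
  -- With 2n < Q_{k+1}, the minimal distance 1/(2Q_{k+1}) holds for all multiples up to n; Q_k ≤ 2n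
  -- keeps the number of blocks of order n/Q_k.
  obtain ⟨k, hkk, hk1, hk2⟩ : ∃ k, k₀ ≤ k ∧ Q k ≤ 2 * n ∧ 2 * n < Q (k + 1) := by
    have hs := Nat.find_spec hex
    have hgt : k₀ < Nat.find hex := by
      by_contra h
      have := hmono (not_lt.1 h)
      have := hpos k₀
      omega
    refine ⟨Nat.find hex - 1, by omega, ?_, ?_⟩
    · exact not_lt.1 (Nat.find_min hex (by omega))
    · rwa [show Nat.find hex - 1 + 1 = Nat.find hex by omega]
  have hq : (0 : ℝ) < Q k := by exact_mod_cast hpos k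
  have hq' : (0 : ℝ) < Q (k + 1) := by exact_mod_cast hpos (k + 1)
  -- Indices in a block of this length differ by at most Q_k/2, so the points y m of a block are
  -- 1/(2Q_k)-separated.
  set b := Q k / 2 + 1 with hb
  have hblock : ∀ i ∈ Finset.range (n / b + 1),
      ∑ m ∈ (Finset.range n).filter (fun m => m / b = i), max 0 (Real.log (η / |y m|)) ≤
        2 * (η / 8 * Q k) + 2 * (η / (1 / (2 * (Q k : ℝ)))) := by
    intro i _
    have hsepar : ∀ m m' : ℕ, m / b = i → m' / b = i → m < m' →
        1 / (2 * (Q k : ℝ)) ≤ |y m' - y m| := by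
      intro m m' hm hm' hlt
      have hdiff : 2 * (m' - m) ≤ Q k := by
        have e1 := Nat.div_add_mod m b
        have e2 := Nat.div_add_mod m' b
        have e3 := Nat.mod_lt m' (show 0 < b by omega)
        rw [hm] at e1; rw [hm'] at e2
        omega
      have h1 := le_abs_mul_sub_int (hpos k) (hmono k.le_succ) (hcop k) (happ k)
        (show 0 < m' - m by omega) hdiff
        (round (((m' + 1 : ℕ) : ℝ) * χ) - round (((m + 1 : ℕ) : ℝ) * χ))
      convert h1 using 2
      simp only [hy]
      rw [Nat.cast_sub hlt.le]
      push_cast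
      ring
    refine (sum_truncLog_le_of_separated _ y (d := 1 / (2 * (Q k : ℝ)))
      (δ := 1 / (2 * (Q (k + 1) : ℝ))) (by positivity) (by positivity) hη ?_ ?_).trans ?_
    · intro m hm m' hm' hne
      simp only [Finset.mem_filter, Finset.mem_range] at hm hm'
      rcases lt_or_gt_of_ne hne with h | h
      · rw [abs_sub_comm]; exact hsepar m m' hm.2 hm'.2 h
      · exact hsepar m' m hm'.2 hm.2 h
    · intro m hm
      simp only [Finset.mem_filter, Finset.mem_range] at hm
      exact le_abs_mul_sub_int (hpos (k + 1)) (hmono (k + 1).le_succ) (hcop (k + 1)) (happ (k + 1))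
        (Nat.succ_pos m) (by omega) _
    · gcongr
      exact hk₀ k hkk
  have hnb : ((n / b + 1 : ℕ) : ℝ) ≤ 4 * n / Q k := by
    have h1 : ((n / b : ℕ) : ℝ) ≤ n / b := Nat.cast_div_le
    have h2 : (Q k : ℝ) / 2 ≤ b := by
      have : Q k ≤ 2 * b := by omega
      have : (Q k : ℝ) ≤ 2 * b := by exact_mod_cast this
      linarith
    have h3 : (n : ℝ) / b ≤ n / (Q k / 2) := by gcongr
    have h4 : (Q k : ℝ) ≤ 2 * n := by exact_mod_cast hk1
    have h5 : (1 : ℝ) ≤ 2 * n / Q k := by rwa [one_le_div hq]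
    push_cast
    calc ((n / b : ℕ) : ℝ) + 1 ≤ n / (Q k / 2) + 2 * n / Q k := by linarith
      _ = 4 * n / Q k := by field_simp; ring
  rw [← Finset.sum_fiberwise_of_maps_to (s := Finset.range n) (t := Finset.range (n / b + 1))
    (g := fun m => m / b)]
  · refine (Finset.sum_le_sum hblock).trans ?_
    rw [Finset.sum_const, Finset.card_range, nsmul_eq_mul]
    -- At most 4n/Q_k blocks, each costing ηQ_k/4 + 4ηQ_k, give the constant 17.
    calc ((n / b + 1 : ℕ) : ℝ) * (2 * (η / 8 * Q k) + 2 * (η / (1 / (2 * (Q k : ℝ)))))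
        ≤ 4 * n / Q k * (2 * (η / 8 * Q k) + 2 * (η / (1 / (2 * (Q k : ℝ))))) := by gcongr
      _ = 17 * η * n := by field_simp; ring
  · intro m hm
    simp only [Finset.mem_range] at hm ⊢
    exact Nat.lt_succ_of_le (Nat.div_le_div_right hm.le)

/-! ### Equidistribution of multiples of an irrational number -/

/-- The sum is geometric with ratio z ≠ 1 of modulus 1, hence bounded by 2/|z - 1| independently of
n. -/
lemma tendsto_average_exp {χ : ℝ} (hχ : Irrational χ) {k : ℤ} (hk : k ≠ 0) :
    Tendsto (fun n : ℕ => (n : ℂ)⁻¹ * ∑ m ∈ Finset.range n,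
      Complex.exp (2 * Real.pi * Complex.I * k * (m * χ))) atTop (𝓝 0) := by
  set z : ℂ := Complex.exp (2 * Real.pi * Complex.I * k * χ) with hz
  have hz1 : z ≠ 1 := by
    intro h
    obtain ⟨n, hn⟩ := Complex.exp_eq_one_iff.1 h
    have h2 : (k : ℂ) * χ = n := by
      have h0 : (2 * Real.pi * Complex.I : ℂ) ≠ 0 := Complex.two_pi_I_ne_zero
      apply mul_left_cancel₀ h0
      linear_combination hn
    have h3 : (k : ℝ) * χ = n := by exact_mod_cast h2
    exact (hχ.intCast_mul hk).ne_int n h3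
  have hpow : ∀ m : ℕ, Complex.exp (2 * Real.pi * Complex.I * k * (m * χ)) = z ^ m := fun m => by
    rw [hz, ← Complex.exp_nat_mul]; congr 1; ring
  have hzn : ‖z‖ = 1 := by
    rw [hz, show (2 * Real.pi * Complex.I * k * χ : ℂ) = ((2 * Real.pi * k * χ : ℝ) : ℂ) *
      Complex.I by push_cast; ring, Complex.norm_exp_ofReal_mul_I]
  have hne : z - 1 ≠ 0 := sub_ne_zero.2 hz1
  simp_rw [hpow, geom_sum_eq hz1]
  rw [tendsto_zero_iff_norm_tendsto_zero]
  have hlim : Tendsto (fun n : ℕ => (n : ℝ)⁻¹ * (2 / ‖z - 1‖)) atTop (𝓝 0) := by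
    simpa using (tendsto_inv_atTop_nhds_zero_nat (𝕜 := ℝ)).mul_const (2 / ‖z - 1‖)
  refine squeeze_zero (fun n => norm_nonneg _) (fun n => ?_) hlim
  rw [norm_mul, norm_inv, Complex.norm_natCast, norm_div]
  gcongr
  calc ‖z ^ n - 1‖ ≤ ‖z ^ n‖ + ‖(1 : ℂ)‖ := norm_sub_le _ _
    _ = 2 := by rw [norm_pow, hzn]; norm_num

lemma integral_fourier_unitAddCircle (k : ℤ) :
    ∫ x : UnitAddCircle, fourier k x = if k = 0 then 1 else 0 := by
  rw [← UnitAddCircle.intervalIntegral_preimage 0]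
  simp only [fourier_coe_apply, zero_add]
  split_ifs with hk
  · simp [hk]
  · have hk' : (2 * Real.pi * Complex.I * k : ℂ) ≠ 0 :=
      mul_ne_zero Complex.two_pi_I_ne_zero (by exact_mod_cast hk)
    have h1 : ∀ x : ℝ, (2 * Real.pi * Complex.I * k * x / (1 : ℝ) : ℂ) =
        2 * Real.pi * Complex.I * k * x := fun x => by simp
    simp_rw [h1]
    rw [integral_exp_mul_complex hk']
    have h2 : Complex.exp (2 * Real.pi * Complex.I * k) = 1 :=
      Complex.exp_eq_one_iff.2 ⟨k, by ring⟩
    simp [h2]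

/-- Weyl's equidistribution theorem on the circle. -/
lemma tendsto_average_unitAddCircle {χ : ℝ} (hχ : Irrational χ) (f : C(UnitAddCircle, ℂ)) :
    Tendsto (fun n : ℕ => (n : ℂ)⁻¹ * ∑ m ∈ Finset.range n,
      f ((m * χ : ℝ) : UnitAddCircle)) atTop (𝓝 (∫ x : UnitAddCircle, f x)) := by
  set S : ℕ → C(UnitAddCircle, ℂ) → ℂ := fun n f => (n : ℂ)⁻¹ * ∑ m ∈ Finset.range n,
      f ((m * χ : ℝ) : UnitAddCircle) with hS
  -- Averages and integral are both 1-Lipschitz in the sup norm, so convergence on trigonometric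
  -- polynomials extends to their closure.
  have hSb : ∀ n f g, ‖S n f - S n g‖ ≤ ‖f - g‖ := by
    intro n f g
    simp only [hS]
    rw [← mul_sub, ← Finset.sum_sub_distrib, norm_mul, norm_inv, Complex.norm_natCast]
    have h1 : ‖∑ m ∈ Finset.range n, (f ((m * χ : ℝ) : UnitAddCircle) -
        g ((m * χ : ℝ) : UnitAddCircle))‖ ≤ n * ‖f - g‖ := by
      refine (norm_sum_le_of_le _ fun m _ => ?_ : _ ≤ ∑ m ∈ Finset.range n, ‖f - g‖).trans ?_
      · rw [← ContinuousMap.sub_apply]; exact ContinuousMap.norm_coe_le_norm _ _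
      · simp
    rcases Nat.eq_zero_or_pos n with rfl | hn
    · simp
    · have : (0 : ℝ) < n := by exact_mod_cast hn
      rw [inv_mul_le_iff₀ this]; exact h1
  have hIb : ∀ f g : C(UnitAddCircle, ℂ),
      ‖(∫ x : UnitAddCircle, f x) - ∫ x : UnitAddCircle, g x‖ ≤ ‖f - g‖ := by
    intro f g
    have hint : ∀ f : C(UnitAddCircle, ℂ), Integrable (fun x => f x) (volume : Measure UnitAddCircle) :=
      fun f => f.continuous.integrable_of_hasCompactSupport (HasCompactSupport.of_compactSpace _)
    rw [← integral_sub (hint f) (hint g)]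
    have := norm_integral_le_of_norm_le_const (μ := (volume : Measure UnitAddCircle))
      (f := fun x => f x - g x) (C := ‖f - g‖)
      (Eventually.of_forall fun x => by
        rw [← ContinuousMap.sub_apply]; exact ContinuousMap.norm_coe_le_norm _ _)
    have hv : (volume : Measure UnitAddCircle).real Set.univ = 1 := by
      simp [Measure.real, AddCircle.measure_univ]
    rwa [hv, mul_one] at this
  have hspan : ∀ f ∈ Submodule.span ℂ (Set.range (@fourier 1)),
      Tendsto (fun n => S n f) atTop (𝓝 (∫ x : UnitAddCircle, f x)) := by
    intro f hf
    induction hf using Submodule.span_induction with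
    | mem f hf =>
      obtain ⟨k, rfl⟩ := hf
      rw [integral_fourier_unitAddCircle]
      split_ifs with hk
      · subst hk
        refine tendsto_const_nhds.congr' ?_
        filter_upwards [eventually_ne_atTop 0] with n hn
        have : (n : ℂ) ≠ 0 := by exact_mod_cast hn
        simp [hS, this]
      · refine (tendsto_average_exp hχ hk).congr fun n => ?_
        simp only [hS]
        congr 1
        refine Finset.sum_congr rfl fun m _ => ?_
        rw [fourier_coe_apply]
        push_cast
        simp
    | zero => simp [hS]
    | add f g _ _ hf hg =>
      have hint : ∀ f : C(UnitAddCircle, ℂ), Integrable (fun x => f x) (volume : Measure UnitAddCircle) :=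
        fun f => f.continuous.integrable_of_hasCompactSupport (HasCompactSupport.of_compactSpace _)
      have : ∫ x : UnitAddCircle, (f + g) x = (∫ x : UnitAddCircle, f x) + ∫ x : UnitAddCircle, g x := by
        simp only [ContinuousMap.add_apply]; exact integral_add (hint f) (hint g)
      rw [this]
      refine (hf.add hg).congr fun n => ?_
      simp [hS, Finset.sum_add_distrib, mul_add]
    | smul c f _ hf =>
      have : ∫ x : UnitAddCircle, (c • f) x = c * ∫ x : UnitAddCircle, f x := by
        simp only [ContinuousMap.smul_apply, smul_eq_mul]; exact integral_const_mul _ _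
      rw [this]
      refine (hf.const_mul c).congr fun n => ?_
      simp [hS, Finset.mul_sum, mul_left_comm]
  have hdense : f ∈ closure (Submodule.span ℂ (Set.range (@fourier 1)) : Set C(UnitAddCircle, ℂ)) := by
    have h := span_fourier_closure_eq_top (T := 1)
    rw [← Submodule.topologicalClosure_coe, h]
    trivial
  rw [Metric.tendsto_atTop]
  intro ε hε
  obtain ⟨g, hg, hfg⟩ := Metric.mem_closure_iff.1 hdense (ε / 3) (by positivity)
  obtain ⟨n₀, hn₀⟩ := Metric.tendsto_atTop.1 (hspan g hg) (ε / 3) (by positivity)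
  refine ⟨n₀, fun n hn => ?_⟩
  have h1 := hSb n f g
  have h2 := hIb g f
  rw [← dist_eq_norm, ← dist_eq_norm] at h1 h2
  rw [dist_comm g f] at h2
  have h3 := hn₀ n hn
  have h4 := dist_triangle4 (S n f) (S n g) (∫ x : UnitAddCircle, g x) (∫ x : UnitAddCircle, f x)
  linarith

/-- Weyl's equidistribution theorem for continuous periodic functions on the line. -/
lemma tendsto_average_of_periodic {χ : ℝ} (hχ : Irrational χ) {f : ℝ → ℝ} (hf : Continuous f)
    (hper : Function.Periodic f 1) :
    Tendsto (fun n : ℕ => (n : ℝ)⁻¹ * ∑ m ∈ Finset.range n, f (m * χ)) atTop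
      (𝓝 (∫ x in (0 : ℝ)..1, f x)) := by
  have hper' : Function.Periodic (fun x => (f x : ℂ)) 1 := fun x => by simp [hper x]
  have hcont : Continuous hper'.lift := by
    refine continuous_coinduced_dom.2 ?_
    exact Complex.continuous_ofReal.comp hf
  have h := tendsto_average_unitAddCircle hχ ⟨hper'.lift, hcont⟩
  have h2 : ∫ x : UnitAddCircle, hper'.lift x = ((∫ x in (0 : ℝ)..1, f x : ℝ) : ℂ) := by
    rw [← UnitAddCircle.intervalIntegral_preimage 0, ← intervalIntegral.integral_ofReal]
    simp [Function.Periodic.lift_coe]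
  simp only [ContinuousMap.coe_mk, h2, Function.Periodic.lift_coe] at h
  have h3 := (Complex.continuous_re.tendsto _).comp h
  rw [Complex.ofReal_re] at h3
  refine h3.congr fun n => ?_
  rw [Function.comp_apply, ← Complex.ofReal_natCast, ← Complex.ofReal_inv, ← Complex.ofReal_sum,
    ← Complex.ofReal_mul, Complex.ofReal_re]

/-! ### The infinite Pochhammer symbol and the theta function -/

section Theta

variable {p : ℂ}

lemma summable_norm_mul_pow (hp : ‖p‖ < 1) (z : ℂ) : Summable fun n : ℕ => ‖-(z * p ^ n)‖ := by
  simp only [norm_neg, norm_mul, norm_pow]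
  exact (summable_geometric_of_lt_one (norm_nonneg _) hp).mul_left _

lemma multipliable_one_sub_mul_pow (hp : ‖p‖ < 1) (z : ℂ) :
    Multipliable fun n : ℕ => 1 - z * p ^ n := by
  simpa only [← sub_eq_add_neg] using multipliable_one_add_of_summable (summable_norm_mul_pow hp z)

lemma pochInf_eq_one_sub_mul (hp : ‖p‖ < 1) (z : ℂ) :
    pochInf z p = (1 - z) * pochInf (p * z) p := by
  have he : (fun n : ℕ => 1 - p * z * p ^ n) = fun n : ℕ => 1 - z * p ^ (n + 1) := by
    funext n; ring
  have hm := multipliable_one_sub_mul_pow hp (p * z)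
  unfold pochInf
  rw [he] at hm ⊢
  rw [tprod_eq_zero_mul' (f := fun n : ℕ => 1 - z * p ^ n) hm]
  congr 1
  simp only [pow_zero, mul_one]

lemma pochInf_eq_zero_iff (hp : ‖p‖ < 1) (z : ℂ) : pochInf z p = 0 ↔ ∃ n : ℕ, z * p ^ n = 1 := by
  constructor
  · intro h
    by_contra! hne
    refine tprod_one_add_ne_zero_of_summable (f := fun n : ℕ => -(z * p ^ n)) (fun n => ?_)
      (summable_norm_mul_pow hp z) ?_
    · rw [← sub_eq_add_neg, sub_ne_zero]; exact (hne n).symm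
    · simpa only [← sub_eq_add_neg, pochInf] using h
  · rintro ⟨n, hn⟩
    exact tprod_of_exists_eq_zero ⟨n, by rw [hn, sub_self]⟩

lemma differentiable_pochInf (hp : ‖p‖ < 1) : Differentiable ℂ fun z => pochInf z p := by
  have hprod : HasProdLocallyUniformlyOn (fun (n : ℕ) (z : ℂ) => 1 + -(z * p ^ n))
      (fun z => ∏' n : ℕ, (1 + -(z * p ^ n))) Set.univ := by
    refine hasProdLocallyUniformlyOn_of_forall_compact isOpen_univ fun K _ hK => ?_
    obtain ⟨R, hR⟩ := hK.isBounded.exists_norm_le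
    refine ((summable_geometric_of_lt_one (norm_nonneg _) hp).mul_left
      R).hasProdUniformlyOn_nat_one_add hK
      (.of_forall fun n x hx => ?_) (fun _ => by fun_prop)
    rw [norm_neg, norm_mul, norm_pow]
    gcongr
    exact hR x hx
  have := hprod.differentiableOn (.of_forall fun _ => by
    simpa [Finset.prod_fn] using DifferentiableOn.finsetProd (fun _ _ => by fun_prop)) isOpen_univ
  rw [differentiableOn_univ] at this
  simpa only [← sub_eq_add_neg, pochInf] using this

lemma theta_mul_nome (hp : ‖p‖ < 1) (hp0 : p ≠ 0) {z : ℂ} (hz : z ≠ 0) :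
    theta (p * z) p = -z⁻¹ * theta z p := by
  have h1 := pochInf_eq_one_sub_mul hp z
  have h2 := pochInf_eq_one_sub_mul hp z⁻¹
  have h3 : p * (p * z)⁻¹ = z⁻¹ := by field_simp
  rw [theta, theta, h3, h1, h2]
  field_simp
  ring

lemma theta_inv (hp : ‖p‖ < 1) (hp0 : p ≠ 0) {z : ℂ} (hz : z ≠ 0) :
    theta z⁻¹ p = -z⁻¹ * theta z p := by
  rw [← theta_mul_nome hp hp0 hz, theta, theta, inv_inv, mul_comm]
  congr 2
  field_simp

lemma theta_eq_zero_iff (hp : ‖p‖ < 1) (hp0 : p ≠ 0) {z : ℂ} (hz : z ≠ 0) :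
    theta z p = 0 ↔ ∃ k : ℤ, z = p ^ k := by
  rw [theta, mul_eq_zero, pochInf_eq_zero_iff hp, pochInf_eq_zero_iff hp]
  constructor
  · rintro (⟨n, hn⟩ | ⟨n, hn⟩)
    · refine ⟨-n, ?_⟩
      rw [zpow_neg, zpow_natCast]
      exact eq_inv_of_mul_eq_one_left hn
    · refine ⟨n + 1, ?_⟩
      rw [zpow_add_one₀ hp0, zpow_natCast]
      field_simp at hn
      rw [← hn]; ring
  · rintro ⟨k, rfl⟩
    rcases le_or_gt k 0 with hk | hk
    · left
      obtain ⟨n, rfl⟩ := Int.eq_ofNat_of_zero_le (neg_nonneg.2 hk) |>.imp fun n h => neg_eq_iff_eq_neg.1 h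
      exact ⟨n, by rw [zpow_neg, zpow_natCast]; field_simp⟩
    · right
      obtain ⟨n, hn⟩ := Int.eq_ofNat_of_zero_le (show 0 ≤ k - 1 by omega)
      obtain rfl : k = n + 1 := by omega
      exact ⟨n, by rw [zpow_add_one₀ hp0, zpow_natCast]; field_simp⟩

end Theta

/-! ### The theta function on the universal cover -/

section Lift

variable {τ : ℂ}

lemma norm_nome_lt_one (hτ : 0 < τ.im) : ‖nome τ‖ < 1 := by
  rw [nome, Complex.norm_exp, Real.exp_lt_one_iff]
  simp
  positivity

lemma nome_ne_zero : nome τ ≠ 0 := Complex.exp_ne_zero _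

/-- The theta function in the additive variable. -/
noncomputable def thetaLift (τ v : ℂ) : ℂ := theta (Complex.exp (2 * Real.pi * Complex.I * v)) (nome τ)

/-- Isolates the factor vanishing at v = 0, so that the derivative there is read off from the
remaining product. -/
lemma thetaLift_eq (hτ : 0 < τ.im) (v : ℂ) : thetaLift τ v =
    (1 - Complex.exp (2 * Real.pi * Complex.I * v)) *
      (pochInf (nome τ * Complex.exp (2 * Real.pi * Complex.I * v)) (nome τ) *
        pochInf (nome τ * Complex.exp (-(2 * Real.pi * Complex.I * v))) (nome τ)) := by
  rw [thetaLift, theta, pochInf_eq_one_sub_mul (norm_nome_lt_one hτ), Complex.exp_neg, mul_assoc]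

lemma differentiable_pochInf_exp (hτ : 0 < τ.im) : Differentiable ℂ fun v : ℂ =>
    pochInf (nome τ * Complex.exp (2 * Real.pi * Complex.I * v)) (nome τ) *
        pochInf (nome τ * Complex.exp (-(2 * Real.pi * Complex.I * v))) (nome τ) := by
  have h := differentiable_pochInf (norm_nome_lt_one hτ)
  exact (h.comp (by fun_prop : Differentiable ℂ fun v : ℂ =>
    nome τ * Complex.exp (2 * Real.pi * Complex.I * v))).mul
    (h.comp (by fun_prop : Differentiable ℂ fun v : ℂ =>
    nome τ * Complex.exp (-(2 * Real.pi * Complex.I * v))))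

lemma differentiable_thetaLift (hτ : 0 < τ.im) : Differentiable ℂ (thetaLift τ) := by
  rw [show thetaLift τ = _ from funext (thetaLift_eq hτ)]
  exact (by fun_prop : Differentiable ℂ fun v : ℂ =>
    1 - Complex.exp (2 * Real.pi * Complex.I * v)).mul (differentiable_pochInf_exp hτ)

lemma thetaLift_zero (hτ : 0 < τ.im) : thetaLift τ 0 = 0 := by simp [thetaLift_eq hτ]

lemma deriv_thetaLift_zero_ne_zero (hτ : 0 < τ.im) : deriv (thetaLift τ) 0 ≠ 0 := by
  have h1 : HasDerivAt (fun v : ℂ => 1 - Complex.exp (2 * Real.pi * Complex.I * v))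
      (-(2 * Real.pi * Complex.I)) 0 := by
    have := (((hasDerivAt_id (0 : ℂ)).const_mul (2 * Real.pi * Complex.I)).cexp).const_sub 1
    simpa using this
  have h2 := h1.mul (differentiable_pochInf_exp hτ 0).hasDerivAt
  rw [show thetaLift τ = _ from funext (thetaLift_eq hτ)]
  erw [h2.deriv]
  have hne : pochInf (nome τ) (nome τ) ≠ 0 := by
    rw [Ne, pochInf_eq_zero_iff (norm_nome_lt_one hτ)]
    rintro ⟨n, hn⟩
    have h3 := congrArg norm hn
    rw [← pow_succ', norm_pow, norm_one] at h3
    exact (pow_lt_one₀ (norm_nonneg _) (norm_nome_lt_one hτ) n.succ_ne_zero).ne h3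
  simp [hne]

lemma thetaLift_eq_zero_iff (hτ : 0 < τ.im) (v : ℂ) :
    thetaLift τ v = 0 ↔ ∃ a b : ℤ, v = a + b * τ := by
  rw [thetaLift, theta_eq_zero_iff (norm_nome_lt_one hτ) nome_ne_zero (Complex.exp_ne_zero _)]
  constructor
  · rintro ⟨k, hk⟩
    rw [nome, ← Complex.exp_int_mul, Complex.exp_eq_exp_iff_exists_int] at hk
    obtain ⟨n, hn⟩ := hk
    refine ⟨n, k, mul_left_cancel₀ Complex.two_pi_I_ne_zero ?_⟩
    linear_combination hn
  · rintro ⟨a, b, rfl⟩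
    refine ⟨b, ?_⟩
    rw [nome, ← Complex.exp_int_mul, Complex.exp_eq_exp_iff_exists_int]
    exact ⟨a, by ring⟩

lemma thetaLift_add_one (v : ℂ) : thetaLift τ (v + 1) = thetaLift τ v := by
  rw [thetaLift, mul_add, Complex.exp_add, mul_one, Complex.exp_two_pi_mul_I, mul_one, thetaLift]

lemma thetaLift_add_tau (hτ : 0 < τ.im) (v : ℂ) : thetaLift τ (v + τ) =
    -Complex.exp (-(2 * Real.pi * Complex.I * v)) * thetaLift τ v := by
  rw [thetaLift, mul_add, Complex.exp_add, mul_comm, ← nome,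
    theta_mul_nome (norm_nome_lt_one hτ) nome_ne_zero (Complex.exp_ne_zero _), Complex.exp_neg,
    thetaLift]

lemma thetaLift_neg (hτ : 0 < τ.im) (v : ℂ) : thetaLift τ (-v) =
    -Complex.exp (-(2 * Real.pi * Complex.I * v)) * thetaLift τ v := by
  rw [thetaLift, mul_neg, Complex.exp_neg,
    theta_inv (norm_nome_lt_one hτ) nome_ne_zero (Complex.exp_ne_zero _), thetaLift]

/-- The absolute value of the theta function, corrected so as to be doubly periodic. -/
noncomputable def thetaNorm (τ v : ℂ) : ℝ :=
  ‖thetaLift τ v‖ * Real.exp (Real.pi * v.im - Real.pi * v.im ^ 2 / τ.im)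

lemma continuous_thetaNorm (hτ : 0 < τ.im) : Continuous (thetaNorm τ) := by
  have := (differentiable_thetaLift hτ).continuous
  unfold thetaNorm
  fun_prop

lemma thetaNorm_pos_iff (v : ℂ) : 0 < thetaNorm τ v ↔ thetaLift τ v ≠ 0 := by
  rw [thetaNorm, mul_pos_iff_of_pos_right (Real.exp_pos _), norm_pos_iff]

lemma norm_exp_neg_two_pi_I_mul (v : ℂ) :
    ‖Complex.exp (-(2 * Real.pi * Complex.I * v))‖ = Real.exp (2 * Real.pi * v.im) := by
  rw [Complex.norm_exp]; congr 1; simp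

lemma thetaNorm_add_one (v : ℂ) : thetaNorm τ (v + 1) = thetaNorm τ v := by
  simp [thetaNorm, thetaLift_add_one]

lemma thetaNorm_add_tau (hτ : 0 < τ.im) (v : ℂ) : thetaNorm τ (v + τ) = thetaNorm τ v := by
  rw [thetaNorm, thetaNorm, thetaLift_add_tau hτ, norm_mul, norm_neg, norm_exp_neg_two_pi_I_mul,
    mul_right_comm, ← Real.exp_add, mul_comm]
  congr 2
  rw [Complex.add_im]
  field_simp
  ring

lemma thetaNorm_neg (hτ : 0 < τ.im) (v : ℂ) : thetaNorm τ (-v) = thetaNorm τ v := by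
  rw [thetaNorm, thetaNorm, thetaLift_neg hτ, norm_mul, norm_neg, norm_exp_neg_two_pi_I_mul,
    mul_right_comm, ← Real.exp_add, mul_comm]
  congr 2
  rw [Complex.neg_im]
  ring

lemma thetaNorm_add_lattice (hτ : 0 < τ.im) (v : ℂ) (a b : ℤ) :
    thetaNorm τ (v + (a + b * τ)) = thetaNorm τ v := by
  have h1 : Function.Periodic (thetaNorm τ) 1 := thetaNorm_add_one
  have h2 : Function.Periodic (thetaNorm τ) τ := thetaNorm_add_tau hτ
  rw [← add_assoc, h2.int_mul b, ← mul_one (a : ℂ), h1.int_mul a]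

/-- Here log|z| = -2π Im v, so the exponent is exactly the inverse of the Gaussian correction in
`thetaNorm`. -/
lemma norm_theta_exp_mul (v : ℂ) (z : ℂ) (hz : z = Complex.exp (2 * Real.pi * Complex.I * v)) :
    ‖theta z (nome τ)‖ = thetaNorm τ v *
      Real.exp (Real.log ‖z‖ ^ 2 / (4 * Real.pi * τ.im) + Real.log ‖z‖ / 2) := by
  have h : Real.log ‖z‖ = -(2 * Real.pi * v.im) := by
    rw [hz, Complex.norm_exp, Real.log_exp]; simp
  rw [thetaNorm, mul_assoc, ← Real.exp_add, h, hz, thetaLift]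
  rw [show Real.pi * v.im - Real.pi * v.im ^ 2 / τ.im + ((-(2 * Real.pi * v.im)) ^ 2 /
    (4 * Real.pi * τ.im) + -(2 * Real.pi * v.im) / 2) = 0 by
      have := Real.pi_pos.ne'
      by_cases hτ : τ.im = 0
      · simp [hτ]; ring
      · field_simp; ring, Real.exp_zero, mul_one]

end Lift

/-! ### Coordinates adapted to a primitive lattice vector -/

section Coordinates

variable {τ : ℂ} {N M : ℤ}

/-- The lattice vector `N + M τ`. -/
noncomputable def latticeVec (N M : ℤ) (τ : ℂ) : ℂ := N + M * τ

/-- The coordinate transversal to the lattice vector `N + M τ`, integral on the lattice. -/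
noncomputable def transCoord (N M : ℤ) (τ v : ℂ) : ℝ :=
  ((latticeVec N M τ).im * v.re - (latticeVec N M τ).re * v.im) / τ.im

lemma latticeVec_im : (latticeVec N M τ).im = M * τ.im := by simp [latticeVec]

lemma latticeVec_ne_zero (hτ : 0 < τ.im) (hNM : Int.gcd N M = 1) : latticeVec N M τ ≠ 0 := by
  intro h
  have h1 : (M : ℝ) * τ.im = 0 := by rw [← latticeVec_im (N := N), h, Complex.zero_im]
  have hM : M = 0 := by
    rcases mul_eq_zero.1 h1 with h | h
    · exact_mod_cast h
    · exact absurd h hτ.ne'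
  subst hM
  have hN : N = 0 := by
    have : (N : ℂ) = 0 := by simpa [latticeVec] using h
    exact_mod_cast this
  subst hN
  simp at hNM

lemma transCoord_add (u v : ℂ) :
    transCoord N M τ (u + v) = transCoord N M τ u + transCoord N M τ v := by
  simp only [transCoord, Complex.add_re, Complex.add_im]; ring

lemma transCoord_neg (v : ℂ) : transCoord N M τ (-v) = -transCoord N M τ v := by
  simp only [transCoord, Complex.neg_re, Complex.neg_im]; ring

lemma transCoord_ofReal_mul (x : ℝ) : transCoord N M τ (x * latticeVec N M τ) = 0 := by
  simp only [transCoord, Complex.re_ofReal_mul, Complex.im_ofReal_mul]; ring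

lemma transCoord_lattice (hτ : 0 < τ.im) (a b : ℤ) :
    transCoord N M τ (a + b * τ) = (a * M - b * N : ℤ) := by
  have := hτ.ne'
  simp only [transCoord, latticeVec]
  simp
  field_simp
  ring

lemma transCoord_I_mul (s : ℝ) : transCoord N M τ (-(s * Complex.I * latticeVec N M τ)) =
    s * ‖latticeVec N M τ‖ ^ 2 / τ.im := by
  rw [Complex.sq_norm, Complex.normSq_apply]
  simp only [transCoord]
  simp
  ring

/-- The vectors ω and -iω form an orthogonal real basis, and the transversal coordinate is, up to
scale, the coefficient of -iω. -/
lemma exists_eq_mul_sub_I_mul (hτ : 0 < τ.im) (hNM : Int.gcd N M = 1) (v : ℂ) :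
    ∃ x : ℝ, v = x * latticeVec N M τ +
      -((transCoord N M τ v * (τ.im / ‖latticeVec N M τ‖ ^ 2) : ℝ) * Complex.I *
        latticeVec N M τ) := by
  have hω := latticeVec_ne_zero hτ hNM
  have hn : ‖latticeVec N M τ‖ ^ 2 ≠ 0 := by positivity
  set x := (v / latticeVec N M τ).re
  set y := (v / latticeVec N M τ).im
  have hv : v = x * latticeVec N M τ + -((-y : ℝ) * Complex.I * latticeVec N M τ) := by
    have : v / latticeVec N M τ = x + y * Complex.I := (Complex.re_add_im _).symm
    rw [div_eq_iff hω] at this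
    rw [this]; push_cast; ring
  refine ⟨x, ?_⟩
  have ht : transCoord N M τ v * (τ.im / ‖latticeVec N M τ‖ ^ 2) = -y := by
    conv_lhs => rw [hv]
    rw [transCoord_add, transCoord_ofReal_mul, transCoord_I_mul]
    have := hτ.ne'
    field_simp
    ring
  rw [ht]; exact hv

lemma continuous_transCoord : Continuous (transCoord N M τ) := by
  unfold transCoord; fun_prop

lemma exists_lattice_transCoord_eq (hτ : 0 < τ.im) (hNM : Int.gcd N M = 1) (k : ℤ) :
    ∃ a b : ℤ, transCoord N M τ (a + b * τ) = k := by
  obtain ⟨u, v, huv⟩ := Int.isCoprime_iff_gcd_eq_one.2 hNM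
  refine ⟨k * v, -(k * u), ?_⟩
  rw [transCoord_lattice hτ]
  congr 1
  linear_combination k * huv

lemma thetaLift_ne_zero_of_transCoord (hτ : 0 < τ.im) {v : ℂ}
    (hv : ∀ k : ℤ, transCoord N M τ v ≠ k) : thetaLift τ v ≠ 0 := by
  rw [Ne, thetaLift_eq_zero_iff hτ]
  rintro ⟨a, b, rfl⟩
  exact hv _ (transCoord_lattice hτ a b)

lemma thetaLift_ne_zero_of_transCoord_mem (hτ : 0 < τ.im) {v : ℂ}
    (h0 : 0 < transCoord N M τ v) (h1 : transCoord N M τ v < 1) : thetaLift τ v ≠ 0 := by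
  refine thetaLift_ne_zero_of_transCoord (N := N) (M := M) hτ fun k hk => ?_
  rw [hk] at h0 h1
  have h0' : 0 < k := by exact_mod_cast h0
  have h1' : k < 1 := by exact_mod_cast h1
  omega

/-- Lattice points on the line spanned by a primitive vector are integer multiples of it. -/
lemma exists_int_of_thetaLift_eq_zero (hτ : 0 < τ.im) (hNM : Int.gcd N M = 1) {x : ℝ}
    (h : thetaLift τ (x * latticeVec N M τ) = 0) : ∃ k : ℤ, x = k := by
  obtain ⟨a, b, hab⟩ := (thetaLift_eq_zero_iff hτ _).1 h
  have h1 := transCoord_ofReal_mul (N := N) (M := M) (τ := τ) x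
  rw [hab, transCoord_lattice hτ] at h1
  have h2 : a * M = b * N := by
    have : a * M - b * N = 0 := by exact_mod_cast h1
    omega
  obtain ⟨u, v, huv⟩ := Int.isCoprime_iff_gcd_eq_one.2 hNM
  have ha : a = (u * a + v * b) * N := by linear_combination -a * huv + v * h2
  have hb : b = (u * a + v * b) * M := by linear_combination -b * huv - u * h2
  refine ⟨u * a + v * b, ?_⟩
  have h3 : (x : ℂ) * latticeVec N M τ = (u * a + v * b : ℤ) * latticeVec N M τ := by
    have haC := congrArg (Int.cast : ℤ → ℂ) ha
    have hbC := congrArg (Int.cast : ℤ → ℂ) hb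
    push_cast at haC hbC
    rw [hab, latticeVec]
    push_cast
    linear_combination haC + τ * hbC
  have h4 := mul_right_cancel₀ (latticeVec_ne_zero hτ hNM) h3
  exact_mod_cast h4

end Coordinates

/-! ### The mean value of the logarithm of the theta function along a line -/

section Mean

variable {τ : ℂ} {N M : ℤ}

lemma logDeriv_thetaLift_add_one (v : ℂ) :
    logDeriv (thetaLift τ) (v + 1) = logDeriv (thetaLift τ) v := by
  simp only [logDeriv_apply]
  rw [← deriv_comp_add_const, funext (thetaLift_add_one (τ := τ)), thetaLift_add_one]

lemma logDeriv_thetaLift_add_tau (hτ : 0 < τ.im) {v : ℂ} (hv : thetaLift τ v ≠ 0) :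
    logDeriv (thetaLift τ) (v + τ) = logDeriv (thetaLift τ) v - 2 * Real.pi * Complex.I := by
  have h1 : logDeriv (thetaLift τ) (v + τ) = logDeriv (fun u => thetaLift τ (u + τ)) v := by
    simp only [logDeriv_apply]
    rw [← deriv_comp_add_const]
  have hd : HasDerivAt (fun u : ℂ => -Complex.exp (-(2 * Real.pi * Complex.I * u)))
      (-(Complex.exp (-(2 * Real.pi * Complex.I * v)) * (-(2 * Real.pi * Complex.I * 1)))) v :=
    (((hasDerivAt_id v).const_mul (2 * Real.pi * Complex.I)).neg.cexp).neg
  rw [h1, funext (thetaLift_add_tau hτ),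
    logDeriv_mul v (show (fun u : ℂ => -Complex.exp (-(2 * Real.pi * Complex.I * u))) v ≠ 0 from
      neg_ne_zero.2 (Complex.exp_ne_zero _)) hv hd.differentiableAt
      (differentiable_thetaLift hτ v)]
  rw [logDeriv_apply, hd.deriv]
  have := Complex.exp_ne_zero (-(2 * Real.pi * Complex.I * v))
  field_simp
  ring

lemma logDeriv_thetaLift_add_latticeVec (hτ : 0 < τ.im) {v : ℂ} (hv : thetaLift τ v ≠ 0) :
    logDeriv (thetaLift τ) (v + latticeVec N M τ) =
      logDeriv (thetaLift τ) v - 2 * Real.pi * Complex.I * M := by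
  classical
  have hT : (τ.im : ℂ) ≠ 0 := by exact_mod_cast hτ.ne'
  -- The term in Im v makes the logarithmic derivative doubly periodic. The value 0 at the zeros of
  -- θ removes the side condition, so periods can be iterated to arbitrary integer multiples.
  set k : ℂ → ℂ := fun v => if thetaLift τ v = 0 then 0 else
    logDeriv (thetaLift τ) v + 2 * Real.pi * Complex.I * (v.im / τ.im) with hk
  have hz : ∀ v, thetaLift τ (v + τ) = 0 ↔ thetaLift τ v = 0 := fun v => by
    rw [thetaLift_add_tau hτ, mul_eq_zero, neg_eq_zero]; simp [Complex.exp_ne_zero]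
  have h1 : Function.Periodic k 1 := fun v => by
    simp [hk, thetaLift_add_one, logDeriv_thetaLift_add_one]
  have h2 : Function.Periodic k τ := fun v => by
    simp only [hk, hz]
    split_ifs with h
    · rfl
    · rw [logDeriv_thetaLift_add_tau hτ h, Complex.add_im]
      push_cast
      field_simp
      ring
  have h3 : k (v + latticeVec N M τ) = k v := by
    rw [latticeVec, ← add_assoc, h2.int_mul M, ← mul_one (N : ℂ), h1.int_mul N]
  have hz1 : Function.Periodic (fun v => thetaLift τ v = 0) 1 := fun v => by
    simp [thetaLift_add_one]
  have hz2 : Function.Periodic (fun v => thetaLift τ v = 0) τ := fun v => propext (hz v)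
  have h4 : (thetaLift τ (v + latticeVec N M τ) = 0) = (thetaLift τ v = 0) := by
    have := (hz2.int_mul M (v + N * 1)).trans (hz1.int_mul N v)
    rwa [mul_one, add_assoc] at this
  simp only [hk, h4, if_neg hv, Complex.add_im, latticeVec_im] at h3
  push_cast at h3
  field_simp at h3
  apply mul_right_cancel₀ hT
  linear_combination h3

/-- The strip between two adjacent lines of lattice translates. -/
def strip (N M : ℤ) (τ : ℂ) : Set ℂ := {v | 0 < transCoord N M τ v ∧ transCoord N M τ v < 1}

lemma isOpen_strip : IsOpen (strip N M τ) :=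
  (isOpen_lt continuous_const continuous_transCoord).inter
    (isOpen_lt continuous_transCoord continuous_const)

lemma convex_strip : Convex ℝ (strip N M τ) := by
  have hlin : IsLinearMap ℝ (transCoord N M τ) :=
    ⟨transCoord_add, fun c v => by simp [transCoord]; ring⟩
  exact (convex_halfSpace_gt hlin 0).inter (convex_halfSpace_lt hlin 1)

lemma add_mul_latticeVec_mem_strip {v : ℂ} (hv : v ∈ strip N M τ) (x : ℝ) :
    v + x * latticeVec N M τ ∈ strip N M τ := by
  simpa only [strip, Set.mem_ofPred_eq, transCoord_add, transCoord_ofReal_mul, add_zero] using hv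

lemma add_latticeVec_mem_strip {v : ℂ} (hv : v ∈ strip N M τ) :
    v + latticeVec N M τ ∈ strip N M τ := by
  simpa using add_mul_latticeVec_mem_strip hv 1

lemma exists_primitive_of_convex {U : Set ℂ} (hU : IsOpen U) (hc : Convex ℝ U) {f : ℂ → ℂ}
    (hf : DifferentiableOn ℂ f U) : ∃ g : ℂ → ℂ, ∀ v ∈ U, HasDerivAt g (f v) v := by
  obtain ⟨g, hg⟩ := hc.exists_forall_hasDerivWithinAt hf
  exact ⟨g, fun v hv => (hg v hv).hasDerivAt (hU.mem_nhds hv)⟩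

lemma exists_eq_const_of_hasDerivAt_zero {U : Set ℂ} (hU : IsOpen U) (hc : Convex ℝ U)
    {f : ℂ → ℂ} (hf : ∀ v ∈ U, HasDerivAt f 0 v) : ∃ c, ∀ v ∈ U, f v = c :=
  hU.exists_is_const_of_deriv_eq_zero hc.isPreconnected
    (fun v hv => (hf v hv).differentiableAt.differentiableWithinAt) (fun v hv => (hf v hv).deriv)

/-- The strip is convex and free of zeros, so θ'/θ has a primitive g there, g has a primitive G, and
log|θ| = Re g + const. The integral of Re g is Re((G(v+ω) - G(v))/ω). Integrating g(v+ω) - g(v) = b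
- 2πiMv turns the increment of G into the stated quadratic. -/
lemma exists_integral_log_norm_thetaLift (hτ : 0 < τ.im) (hNM : Int.gcd N M = 1) :
    ∃ (κ : ℝ) (b c : ℂ), ∀ v ∈ strip N M τ,
      ∫ x in (0 : ℝ)..1, Real.log ‖thetaLift τ (v + x * latticeVec N M τ)‖ =
        κ + ((-(Real.pi * Complex.I * M) * v ^ 2 + b * v + c) / latticeVec N M τ).re := by
  set ω := latticeVec N M τ with hω
  have hω0 : ω ≠ 0 := latticeVec_ne_zero hτ hNM
  have hne : ∀ v ∈ strip N M τ, thetaLift τ v ≠ 0 := fun v hv =>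
    thetaLift_ne_zero_of_transCoord_mem hτ hv.1 hv.2
  have hΘ := differentiable_thetaLift hτ
  have hh : DifferentiableOn ℂ (logDeriv (thetaLift τ)) (strip N M τ) := fun v hv =>
    ((hΘ.deriv v).div (hΘ v) (hne v hv)).differentiableWithinAt
  obtain ⟨g, hg⟩ := exists_primitive_of_convex isOpen_strip convex_strip hh
  obtain ⟨G, hG⟩ := exists_primitive_of_convex isOpen_strip convex_strip
    fun v hv => (hg v hv).differentiableAt.differentiableWithinAt
  have htrans : ∀ {f : ℂ → ℂ} {f' : ℂ} {v : ℂ}, HasDerivAt f f' (v + ω) →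
      HasDerivAt (fun u => f (u + ω)) f' v := fun h => h.comp_add_const _ _
  obtain ⟨k, hk⟩ := exists_eq_const_of_hasDerivAt_zero
    (f := fun v => thetaLift τ v * Complex.exp (-g v))
    (isOpen_strip (N := N) (M := M) (τ := τ)) convex_strip fun v hv => by
      have := (hΘ v).hasDerivAt.mul (hg v hv).neg.cexp
      convert! this using 1
      rw [logDeriv_apply]
      field_simp [hne v hv]
      ring
  have hlog : ∀ v ∈ strip N M τ, Real.log ‖thetaLift τ v‖ = Real.log ‖k‖ + (g v).re := by
    intro v hv
    rw [← hk v hv, norm_mul, Complex.norm_exp, Real.log_mul (norm_ne_zero_iff.2 (hne v hv))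
      (Real.exp_ne_zero _), Real.log_exp]
    simp
  obtain ⟨b, hb⟩ := exists_eq_const_of_hasDerivAt_zero
    (f := fun v => g (v + ω) - g v + 2 * Real.pi * Complex.I * M * v)
    (isOpen_strip (N := N) (M := M) (τ := τ)) convex_strip fun v hv => by
      have := ((htrans (hg _ (add_latticeVec_mem_strip hv))).sub (hg v hv)).add
        ((hasDerivAt_id v).const_mul (2 * Real.pi * Complex.I * M))
      convert! this using 1
      rw [logDeriv_thetaLift_add_latticeVec hτ (hne v hv)]
      ring
  obtain ⟨c, hc⟩ := exists_eq_const_of_hasDerivAt_zero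
    (f := fun v => G (v + ω) - G v + Real.pi * Complex.I * M * v ^ 2 - b * v)
    (isOpen_strip (N := N) (M := M) (τ := τ)) convex_strip fun v hv => by
      have := (((htrans (hG _ (add_latticeVec_mem_strip hv))).sub (hG v hv)).add
        ((hasDerivAt_pow 2 v).const_mul (Real.pi * Complex.I * M))).sub
          ((hasDerivAt_id v).const_mul b)
      convert! this using 1
      rw [← hb v hv]
      simp
      ring
  refine ⟨Real.log ‖k‖, b, c, fun v hv => ?_⟩
  have hmem : ∀ x : ℝ, v + x * ω ∈ strip N M τ := fun x => add_mul_latticeVec_mem_strip hv x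
  have hder : ∀ x : ℝ, HasDerivAt (fun x : ℝ => (G (v + x * ω) / ω).re) (g (v + x * ω)).re x := by
    intro x
    have h1 : HasDerivAt (fun z : ℂ => v + z * ω) ω (x : ℂ) := by
      simpa using ((hasDerivAt_id (x : ℂ)).mul_const ω).const_add v
    have h2 : HasDerivAt (fun z : ℂ => G (v + z * ω) / ω) (g (v + x * ω)) (x : ℂ) := by
      have := (HasDerivAt.comp (x : ℂ) (hG _ (hmem x)) h1).div_const ω
      rwa [mul_div_cancel_right₀ _ hω0] at this
    exact h2.real_of_complex
  have hcont : Continuous fun x : ℝ => (g (v + x * ω)).re := by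
    refine Complex.continuous_re.comp (continuous_iff_continuousAt.2 fun x => ?_)
    have h1 : ContinuousAt g (v + x * ω) := (hg _ (hmem x)).continuousAt
    exact h1.comp (f := fun x : ℝ => v + x * ω) (by fun_prop)
  have hint := intervalIntegral.integral_eq_sub_of_hasDerivAt (fun x _ => hder x)
    (hcont.intervalIntegrable 0 1)
  simp_rw [fun x : ℝ => hlog _ (hmem x)]
  rw [intervalIntegral.integral_add (by simp) (hcont.intervalIntegrable 0 1), hint]
  simp only [intervalIntegral.integral_const, sub_zero, one_smul, Complex.ofReal_one, one_mul,
    Complex.ofReal_zero, zero_mul, add_zero]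
  rw [← Complex.sub_re, ← sub_div]
  congr 3
  linear_combination hc v hv

/-- The mean of the logarithm of the normalized theta function along the direction `N + M τ`. -/
noncomputable def meanLog (N M : ℤ) (τ v : ℂ) : ℝ :=
  ∫ x in (0 : ℝ)..1, Real.log (thetaNorm τ (v + x * latticeVec N M τ))

lemma periodic_log_thetaNorm (hτ : 0 < τ.im) (v : ℂ) :
    Function.Periodic (fun x : ℝ => Real.log (thetaNorm τ (v + x * latticeVec N M τ))) 1 := by
  intro x
  simp only
  rw [show v + ((x + 1 : ℝ) : ℂ) * latticeVec N M τ =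
    v + x * latticeVec N M τ + (N + M * τ) by push_cast [latticeVec]; ring,
    thetaNorm_add_lattice hτ]

lemma meanLog_add_lattice (hτ : 0 < τ.im) (v : ℂ) (a b : ℤ) :
    meanLog N M τ (v + (a + b * τ)) = meanLog N M τ v := by
  unfold meanLog
  simp_rw [add_right_comm v, thetaNorm_add_lattice hτ]

lemma meanLog_mul_add (hτ : 0 < τ.im) (v : ℂ) (y : ℝ) :
    meanLog N M τ (y * latticeVec N M τ + v) = meanLog N M τ v := by
  have h1 : meanLog N M τ (y * latticeVec N M τ + v) =
      ∫ x in (0 : ℝ)..1, (fun x : ℝ => Real.log (thetaNorm τ (v + x * latticeVec N M τ))) (x + y) := by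
    unfold meanLog
    refine intervalIntegral.integral_congr fun x _ => ?_
    simp only
    congr 2
    push_cast
    ring
  refine h1.trans ((intervalIntegral.integral_comp_add_right (fun x : ℝ =>
    Real.log (thetaNorm τ (v + x * latticeVec N M τ))) y).trans ?_)
  rw [zero_add, add_comm 1 y, (periodic_log_thetaNorm hτ v).intervalIntegral_add_eq y 0, zero_add, meanLog]

lemma meanLog_neg (hτ : 0 < τ.im) (v : ℂ) : meanLog N M τ (-v) = meanLog N M τ v := by
  have h1 : meanLog N M τ (-v) =
      ∫ x in (0 : ℝ)..1, (fun x : ℝ => Real.log (thetaNorm τ (v + x * latticeVec N M τ))) (-x) := by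
    unfold meanLog
    refine intervalIntegral.integral_congr fun x _ => ?_
    simp only
    rw [← thetaNorm_neg hτ]
    congr 2
    push_cast
    ring
  have h2 := (periodic_log_thetaNorm (N := N) (M := M) hτ v).intervalIntegral_add_eq (-1) 0
  refine h1.trans ((intervalIntegral.integral_comp_neg (fun x : ℝ =>
    Real.log (thetaNorm τ (v + x * latticeVec N M τ)))).trans ?_)
  simpa [meanLog] using h2

/-- The bounds on s say that -isω lies in the strip. The s² term collects -πM Im ω from log|θ| and
-π(Re ω)²/Im τ from the Gaussian; as Im ω = M Im τ, they add up to -π|ω|²/Im τ. -/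
lemma exists_meanLog_quadratic (hτ : 0 < τ.im) (hNM : Int.gcd N M = 1) :
    ∃ c₀ c₁ : ℝ, ∀ s : ℝ, 0 < s → s < τ.im / ‖latticeVec N M τ‖ ^ 2 →
      meanLog N M τ (-(s * Complex.I * latticeVec N M τ)) =
        c₀ + c₁ * s - Real.pi * ‖latticeVec N M τ‖ ^ 2 / τ.im * s ^ 2 := by
  obtain ⟨κ, b, c, h⟩ := exists_integral_log_norm_thetaLift hτ hNM
  set ω := latticeVec N M τ with hω
  have hω0 : ω ≠ 0 := latticeVec_ne_zero hτ hNM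
  have hωn : 0 < ‖ω‖ ^ 2 := by positivity
  have hT := hτ.ne'
  refine ⟨κ + (c / ω).re + Real.pi * (ω.im / 2) - Real.pi * (ω.im ^ 2 / 3) / τ.im,
    (-(b * Complex.I)).re - Real.pi * ω.re + Real.pi * (ω.im * ω.re) / τ.im, fun s hs0 hs1 => ?_⟩
  set v : ℂ := -(s * Complex.I * ω) with hv
  have htv : transCoord N M τ v = s * ‖ω‖ ^ 2 / τ.im := transCoord_I_mul s
  have hmem : v ∈ strip N M τ := by
    refine ⟨by rw [htv]; positivity, ?_⟩
    rw [htv, div_lt_one hτ]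
    exact (lt_div_iff₀ hωn).1 hs1
  have hne : ∀ x : ℝ, thetaLift τ (v + x * ω) ≠ 0 := fun x =>
    have := add_mul_latticeVec_mem_strip hmem x
    thetaLift_ne_zero_of_transCoord_mem hτ this.1 this.2
  have him : ∀ x : ℝ, (v + x * ω).im = ω.im * x - s * ω.re := fun x => by
    simp [hv]; ring
  have hlog : ∀ x : ℝ, Real.log (thetaNorm τ (v + x * ω)) = Real.log ‖thetaLift τ (v + x * ω)‖ +
      (Real.pi * (ω.im * x - s * ω.re) - Real.pi * (ω.im * x - s * ω.re) ^ 2 / τ.im) := fun x => by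
    rw [thetaNorm, Real.log_mul (norm_ne_zero_iff.2 (hne x)) (Real.exp_ne_zero _), Real.log_exp,
      him]
  have hc1 : Continuous fun x : ℝ => Real.log ‖thetaLift τ (v + x * ω)‖ := by
    have := (differentiable_thetaLift hτ).continuous
    exact Continuous.log (by fun_prop) fun x => norm_ne_zero_iff.2 (hne x)
  have hpoly : ∫ x in (0 : ℝ)..1,
      (Real.pi * (ω.im * x - s * ω.re) - Real.pi * (ω.im * x - s * ω.re) ^ 2 / τ.im) =
      Real.pi * (ω.im / 2 - s * ω.re) -
        Real.pi * (ω.im ^ 2 / 3 - ω.im * (s * ω.re) + (s * ω.re) ^ 2) / τ.im := by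
    have hd : ∀ x : ℝ, HasDerivAt (fun x : ℝ => Real.pi * (ω.im * x ^ 2 / 2 - s * ω.re * x) -
        Real.pi * (ω.im ^ 2 * x ^ 3 / 3 - ω.im * (s * ω.re) * x ^ 2 + (s * ω.re) ^ 2 * x) / τ.im)
        (Real.pi * (ω.im * x - s * ω.re) - Real.pi * (ω.im * x - s * ω.re) ^ 2 / τ.im) x := by
      intro x
      have h1 := hasDerivAt_id x
      have h2 := hasDerivAt_pow 2 x
      have h3 := hasDerivAt_pow 3 x
      have := ((((h2.const_mul ω.im).div_const 2).sub (h1.const_mul (s * ω.re))).const_mul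
        Real.pi).sub ((((((h3.const_mul (ω.im ^ 2)).div_const 3).sub
          (h2.const_mul (ω.im * (s * ω.re)))).add (h1.const_mul ((s * ω.re) ^ 2))).const_mul
            Real.pi).div_const τ.im)
      convert! this using 1
      simp
      ring
    rw [intervalIntegral.integral_eq_sub_of_hasDerivAt (fun x _ => hd x)
      (Continuous.intervalIntegrable (by fun_prop) _ _)]
    ring
  rw [meanLog]
  simp_rw [← hω, hlog]
  rw [intervalIntegral.integral_add (hc1.intervalIntegrable _ _)
    (Continuous.intervalIntegrable (by fun_prop) _ _), hpoly, h v hmem]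
  have hq : (-(Real.pi * Complex.I * M) * v ^ 2 + b * v + c) / ω =
      (s ^ 2 * Real.pi * M : ℝ) * (Complex.I * ω) + (s : ℝ) * (-(b * Complex.I)) + c / ω := by
    rw [hv]
    field_simp
    push_cast
    linear_combination (-s ^ 2 * Real.pi * M * Complex.I * ω ^ 2) * Complex.I_sq
  rw [hq, Complex.add_re, Complex.add_re, Complex.re_ofReal_mul, Complex.re_ofReal_mul,
    Complex.I_mul_re, Complex.sq_norm, Complex.normSq_apply]
  have hMT : ω.im = M * τ.im := latticeVec_im
  field_simp
  rw [hMT]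
  ring

/-- The mean of the logarithm of the normalized theta function off the lattice lines. -/
lemma exists_meanLog_eq (hτ : 0 < τ.im) (hNM : Int.gcd N M = 1) :
    ∃ c₀ : ℝ, ∀ v : ℂ, Int.fract (transCoord N M τ v) ≠ 0 → meanLog N M τ v =
      c₀ - Real.pi * τ.im / ‖latticeVec N M τ‖ ^ 2 *
        (Int.fract (transCoord N M τ v) * (Int.fract (transCoord N M τ v) - 1)) := by
  obtain ⟨c₀, c₁, h⟩ := exists_meanLog_quadratic hτ hNM
  set ω := latticeVec N M τ with hω
  have hω0 : ω ≠ 0 := latticeVec_ne_zero hτ hNM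
  have hωn : 0 < ‖ω‖ ^ 2 := by positivity
  set S := τ.im / ‖ω‖ ^ 2 with hS
  have hS0 : 0 < S := by positivity
  -- A lattice translation followed by a shift along ω reduces any point to the segment -isω, 0 ≤ s
  -- < S.
  have hred : ∀ u : ℂ, meanLog N M τ u =
      meanLog N M τ (-((Int.fract (transCoord N M τ u) * S : ℝ) * Complex.I * ω)) := by
    intro u
    obtain ⟨a, b, hab⟩ := exists_lattice_transCoord_eq hτ hNM (-⌊transCoord N M τ u⌋)
    have ht : transCoord N M τ (u + (a + b * τ)) = Int.fract (transCoord N M τ u) := by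
      rw [transCoord_add, hab, Int.fract]; push_cast; ring
    obtain ⟨x, hx⟩ := exists_eq_mul_sub_I_mul hτ hNM (u + (a + b * τ))
    rw [ht] at hx
    rw [← meanLog_add_lattice hτ u a b, hx, meanLog_mul_add hτ]
  -- Evenness exchanges the fractional parts 1/4 and 3/4; equating the quadratic at S/4 and 3S/4
  -- determines the linear coefficient.
  have hsymm : c₁ = Real.pi := by
    have e0 : (0 : ℝ) < S / 4 := by positivity
    have e1 : S / 4 < S := by linarith
    have h1 := h (S / 4) e0 e1
    have h2 := h (3 * S / 4) (by positivity) (by linarith)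
    have hfr : Int.fract (transCoord N M τ (- -((S / 4 : ℝ) * Complex.I * ω))) = 3 / 4 := by
      have ht : transCoord N M τ (-((S / 4 : ℝ) * Complex.I * ω)) = 1 / 4 := by
        rw [transCoord_I_mul, ← hω, hS]; field_simp
      rw [transCoord_neg, ht, Int.fract_eq_iff]
      exact ⟨by norm_num, by norm_num, -1, by norm_num⟩
    have h3 := hred (- -((S / 4 : ℝ) * Complex.I * ω))
    rw [meanLog_neg hτ, hfr, h1, show (3 / 4 * S : ℝ) = 3 * S / 4 by ring, h2] at h3
    have h4 : Real.pi * ‖ω‖ ^ 2 / τ.im * S = Real.pi := by rw [hS]; field_simp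
    have h5 : S * (c₁ - Real.pi) = 0 := by
      linear_combination (-2) * h3 + S * h4
    rcases mul_eq_zero.1 h5 with h | h
    · exact absurd h hS0.ne'
    · linarith
  refine ⟨c₀, fun v hv => ?_⟩
  set β := Int.fract (transCoord N M τ v) with hβ
  have hβ0 : 0 < β := lt_of_le_of_ne (Int.fract_nonneg _) (Ne.symm hv)
  have hβ1 : β < 1 := Int.fract_lt_one _
  rw [hred v, ← hβ, h (β * S) (by positivity) (by nlinarith), hsymm, hS]
  field_simp
  ring

end Mean

/-! ### Averages of the logarithm of the theta function -/

section Average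

variable {τ : ℂ} {N M : ℤ}

lemma thetaLift_ne_zero_of_fract_ne_zero (hτ : 0 < τ.im) {v : ℂ}
    (hv : Int.fract (transCoord N M τ v) ≠ 0) (x : ℝ) :
    thetaLift τ (v + x * latticeVec N M τ) ≠ 0 := by
  refine thetaLift_ne_zero_of_transCoord (N := N) (M := M) hτ fun k hk => hv ?_
  rw [transCoord_add, transCoord_ofReal_mul, add_zero] at hk
  rw [hk, Int.fract_intCast]

lemma tendsto_average_log_thetaNorm (hτ : 0 < τ.im) {χ : ℝ} (hχ : Irrational χ) {v : ℂ}
    (hv : Int.fract (transCoord N M τ v) ≠ 0) :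
    Tendsto (fun n : ℕ => (n : ℝ)⁻¹ * ∑ m ∈ Finset.range n,
      Real.log (thetaNorm τ (v + ((m * χ : ℝ) : ℂ) * latticeVec N M τ))) atTop
      (𝓝 (meanLog N M τ v)) := by
  have hcont : Continuous fun x : ℝ => Real.log (thetaNorm τ (v + x * latticeVec N M τ)) := by
    have := continuous_thetaNorm hτ
    exact Continuous.log (by fun_prop) fun x =>
      ((thetaNorm_pos_iff _).2 (thetaLift_ne_zero_of_fract_ne_zero hτ hv x)).ne'
  exact tendsto_average_of_periodic hχ hcont (periodic_log_thetaNorm hτ v)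

/-- For |x| ≥ η/2 the left side is at most s/|x| ≤ η. For smaller |x|, |x| + s ≤ η/2 + η²/2 ≤ η. -/
lemma log_one_add_div_abs_le {η s x : ℝ} (hη : 0 < η) (hs : 0 < s) (hsη : s ≤ η ^ 2 / 2)
    (hη1 : η ≤ 1) (hx : x ≠ 0) :
    Real.log (1 + s / |x|) ≤ η + max 0 (Real.log (η / |x|)) := by
  have hx' : 0 < |x| := abs_pos.2 hx
  rcases le_or_gt (η / 2) |x| with h | h
  · have h1 : Real.log (1 + s / |x|) ≤ s / |x| := by
      have := Real.log_le_sub_one_of_pos (show 0 < 1 + s / |x| by positivity)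
      linarith
    have h2 : s / |x| ≤ η := by
      rw [div_le_iff₀ hx']
      nlinarith
    linarith [le_max_left 0 (Real.log (η / |x|))]
  · have h1 : 1 + s / |x| ≤ η / |x| := by
      rw [one_add_div hx'.ne']
      gcongr
      nlinarith
    have h2 := Real.log_le_log (by positivity) h1
    linarith [le_max_right 0 (Real.log (η / |x|))]

/-- Near the simple zero, `thetaNorm` is |z| times a continuous nonvanishing K. Uniform continuity
of log K costs η, and passing from |x| to |x - is| costs at most log(1 + s/|x|). -/
lemma exists_abs_log_thetaNorm_sub_le (hτ : 0 < τ.im) (hNM : Int.gcd N M = 1) {η : ℝ}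
    (hη : 0 < η) (hη1 : η ≤ 1) :
    ∃ s : ℝ, 0 < s ∧ s ≤ η ∧ s < τ.im / ‖latticeVec N M τ‖ ^ 2 ∧
      ∀ x : ℝ, x ≠ 0 → |x| ≤ 1 / 2 →
        |Real.log (thetaNorm τ (-(s * Complex.I * latticeVec N M τ) + x * latticeVec N M τ)) -
          Real.log (thetaNorm τ (x * latticeVec N M τ))| ≤
            2 * η + max 0 (Real.log (η / |x|)) := by
  set ω := latticeVec N M τ with hω
  have hω0 : ω ≠ 0 := latticeVec_ne_zero hτ hNM
  have hωn : 0 < ‖ω‖ ^ 2 := by positivity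
  set S := τ.im / ‖ω‖ ^ 2 with hS
  have hS0 : 0 < S := by positivity
  have hΘ := differentiable_thetaLift hτ
  set K : ℂ → ℝ := fun z => ‖dslope (thetaLift τ) 0 z‖ *
    Real.exp (Real.pi * z.im - Real.pi * z.im ^ 2 / τ.im) with hK
  have hKc : Continuous K := by
    have : Continuous (dslope (thetaLift τ) 0) := by
      rw [continuous_iff_continuousAt]
      intro z
      rcases eq_or_ne z 0 with rfl | hz
      · exact continuousAt_dslope_same.2 (hΘ 0)
      · exact (continuousAt_dslope_of_ne hz).2 (hΘ z).continuousAt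
    fun_prop
  have hfac : ∀ z, thetaNorm τ z = ‖z‖ * K z := by
    intro z
    have h1 := sub_smul_dslope (thetaLift τ) 0 z
    rw [thetaLift_zero hτ, sub_zero, sub_zero, smul_eq_mul] at h1
    rw [thetaNorm, ← h1, norm_mul, hK, mul_assoc]
  set pt : ℝ × ℝ → ℂ := fun z => -(z.1 * Complex.I * ω) + z.2 * ω with hpt
  -- The only lattice point in this rectangle is the origin, where `dslope` takes the nonzero value
  -- θ'(0).
  set R : Set (ℝ × ℝ) := Set.Icc 0 (S / 2) ×ˢ Set.Icc (-(1 / 2)) (1 / 2) with hR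
  have hKpos : ∀ z ∈ R, K (pt z) ≠ 0 := by
    rintro ⟨s, x⟩ ⟨⟨hs0, hs1⟩, hx0, hx1⟩
    simp only at hs0 hs1 hx0 hx1
    have hd : dslope (thetaLift τ) 0 (pt (s, x)) ≠ 0 := by
      rcases eq_or_ne (pt (s, x)) 0 with h0 | h0
      · rw [h0, dslope_same]; exact deriv_thetaLift_zero_ne_zero hτ
      · have hne : thetaLift τ (pt (s, x)) ≠ 0 := by
          rcases hs0.eq_or_lt with rfl | hs0
          · intro h
            simp only [hpt, Complex.ofReal_zero, zero_mul, neg_zero, zero_add] at h h0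
            obtain ⟨k, rfl⟩ := exists_int_of_thetaLift_eq_zero hτ hNM h
            have a1 : (-1 : ℝ) < k := by linarith
            have a2 : (k : ℝ) < 1 := by linarith
            have a1' : -1 < k := by exact_mod_cast a1
            have a2' : k < 1 := by exact_mod_cast a2
            obtain rfl : k = 0 := by omega
            simp at h0
          · refine thetaLift_ne_zero_of_transCoord_mem (N := N) (M := M) hτ ?_ ?_ <;>
            simp only [hpt] <;>
            rw [transCoord_add, transCoord_ofReal_mul, transCoord_I_mul, add_zero, ← hω]
            · positivity
            · rw [div_lt_one hτ, ← lt_div_iff₀ hωn, ← hS]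
              linarith
        intro h
        have h1 := sub_smul_dslope (thetaLift τ) 0 (pt (s, x))
        rw [h, smul_zero, thetaLift_zero hτ, sub_zero] at h1
        exact hne h1.symm
    exact mul_ne_zero (norm_ne_zero_iff.2 hd) (Real.exp_ne_zero _)
  have hunif : UniformContinuousOn (fun z => Real.log (K (pt z))) R := by
    refine (isCompact_Icc.prod isCompact_Icc).uniformContinuousOn_of_continuous ?_
    exact ContinuousOn.log (by fun_prop) hKpos
  obtain ⟨δ, hδ, hδR⟩ := Metric.uniformContinuousOn_iff.1 hunif η hη
  -- The three bounds serve uniform continuity, membership in the rectangle, and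
  -- `log_one_add_div_abs_le`.
  set s := min (min (δ / 2) (S / 2)) (η ^ 2 / 2) with hs
  have hs0 : 0 < s := by positivity
  have hs1 : s ≤ δ / 2 := (min_le_left _ _).trans (min_le_left _ _)
  have hs2 : s ≤ S / 2 := (min_le_left _ _).trans (min_le_right _ _)
  have hs3 : s ≤ η ^ 2 / 2 := min_le_right _ _
  refine ⟨s, hs0, by nlinarith, by linarith, fun x hx hx2 => ?_⟩
  have hx' := abs_le.1 hx2
  have hxp : 0 < |x| := abs_pos.2 hx
  have hm1 : (s, x) ∈ R := ⟨⟨hs0.le, hs2⟩, hx'.1, hx'.2⟩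
  have hm0 : ((0 : ℝ), x) ∈ R := ⟨⟨le_rfl, by positivity⟩, hx'.1, hx'.2⟩
  have h1 := hδR (s, x) hm1 (0, x) hm0 (by
    rw [Prod.dist_eq, dist_self, Real.dist_eq, sub_zero, abs_of_pos hs0]
    simp only [sup_lt_iff]
    exact ⟨by linarith, hδ⟩)
  have hpt0 : pt (0, x) = x * ω := by simp [hpt]
  have hpt1 : pt (s, x) = -(s * Complex.I * ω) + x * ω := rfl
  have hfacω : pt (s, x) = (x - s * Complex.I) * ω := by rw [hpt1]; ring
  have hn0 : ‖(x : ℂ) * ω‖ = |x| * ‖ω‖ := by rw [norm_mul, Complex.norm_real, Real.norm_eq_abs]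
  have hωp : 0 < ‖ω‖ := norm_pos_iff.2 hω0
  have hlow : |x| ≤ ‖(x : ℂ) - s * Complex.I‖ := by
    have := Complex.abs_re_le_norm ((x : ℂ) - s * Complex.I)
    simpa using this
  have hup : ‖(x : ℂ) - s * Complex.I‖ ≤ |x| + s := by
    refine (norm_sub_le _ _).trans ?_
    simp [abs_of_pos hs0]
  have hnp : 0 < ‖(x : ℂ) - s * Complex.I‖ := hxp.trans_le hlow
  rw [← hpt1, ← hpt0, hfac, hfac, Real.log_mul (by rw [hfacω, norm_mul]; positivity) (hKpos _ hm1),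
    Real.log_mul (by rw [hpt0, hn0]; positivity) (hKpos _ hm0), hpt0, hn0, hfacω, norm_mul,
    Real.log_mul hnp.ne' hωp.ne', Real.log_mul hxp.ne' hωp.ne', ← hfacω, ← hpt0]
  rw [Real.dist_eq, abs_lt] at h1
  have h2 : 0 ≤ Real.log ‖(x : ℂ) - s * Complex.I‖ - Real.log |x| :=
    sub_nonneg.2 (Real.log_le_log hxp hlow)
  have h3 : Real.log ‖(x : ℂ) - s * Complex.I‖ - Real.log |x| ≤
      η + max 0 (Real.log (η / |x|)) := by
    refine le_trans ?_ (log_one_add_div_abs_le hη hs0 hs3 hη1 hx)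
    rw [one_add_div hxp.ne', Real.log_div (by positivity) hxp.ne']
    exact sub_le_sub_right (Real.log_le_log hnp hup) _
  have h4 := le_max_left 0 (Real.log (η / |x|))
  rw [abs_le]
  constructor <;> linarith [h1.1, h1.2]

/-- The average along the singular orbit, the value being the limit of the means over adjacent
lines. -/
lemma tendsto_average_log_thetaNorm_singular (hτ : 0 < τ.im) (hNM : Int.gcd N M = 1) {χ : ℝ}
    (hχ : Irrational χ) (hHL : HardyLittlewood χ) {c₀ : ℝ}
    (hc₀ : ∀ v : ℂ, Int.fract (transCoord N M τ v) ≠ 0 → meanLog N M τ v =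
      c₀ - Real.pi * τ.im / ‖latticeVec N M τ‖ ^ 2 *
        (Int.fract (transCoord N M τ v) * (Int.fract (transCoord N M τ v) - 1))) :
    Tendsto (fun n : ℕ => (n : ℝ)⁻¹ * ∑ m ∈ Finset.range n,
      Real.log (thetaNorm τ (χ * latticeVec N M τ + ((m * χ : ℝ) : ℂ) * latticeVec N M τ))) atTop
      (𝓝 c₀) := by
  set ω := latticeVec N M τ with hω
  have hω0 : ω ≠ 0 := latticeVec_ne_zero hτ hNM
  have hωn : 0 < ‖ω‖ ^ 2 := by positivity
  rw [Metric.tendsto_atTop]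
  intro ε hε
  -- The total error is below 24η: 19η between the two orbits, η for Weyl's theorem on the shifted
  -- line, and πs ≤ 4η for the change of mean.
  set η := min 1 (ε / 40) with hη
  have hη0 : 0 < η := by positivity
  have hη2 : η ≤ ε / 40 := min_le_right _ _
  obtain ⟨s, hs0, hsη, hsS, hbd⟩ := exists_abs_log_thetaNorm_sub_le hτ hNM hη0 (min_le_left _ _)
  rw [← hω] at hbd hsS
  set v : ℂ := -(s * Complex.I * ω) with hv
  have ht : transCoord N M τ (χ * ω + v) = s * ‖ω‖ ^ 2 / τ.im := by
    rw [transCoord_add, transCoord_ofReal_mul, transCoord_I_mul, zero_add]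
  have ht0 : 0 < s * ‖ω‖ ^ 2 / τ.im := by positivity
  have ht1 : s * ‖ω‖ ^ 2 / τ.im < 1 := by rw [div_lt_one hτ]; exact (lt_div_iff₀ hωn).1 hsS
  have hfr : Int.fract (transCoord N M τ (χ * ω + v)) = s * ‖ω‖ ^ 2 / τ.im := by
    rw [ht]; exact Int.fract_eq_self.2 ⟨ht0.le, ht1⟩
  have hne : Int.fract (transCoord N M τ (χ * ω + v)) ≠ 0 := by rw [hfr]; exact ht0.ne'
  have hmean := hc₀ _ hne
  rw [hfr] at hmean
  have hmean' : |meanLog N M τ (χ * ω + v) - c₀| ≤ Real.pi * s := by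
    rw [hmean, show c₀ - Real.pi * τ.im / ‖ω‖ ^ 2 * (s * ‖ω‖ ^ 2 / τ.im *
      (s * ‖ω‖ ^ 2 / τ.im - 1)) - c₀ = Real.pi * s * (1 - s * ‖ω‖ ^ 2 / τ.im) by
        field_simp; ring, abs_of_nonneg (mul_nonneg (by positivity) (by linarith))]
    exact mul_le_of_le_one_right (by positivity) (by linarith)
  have h1 := tendsto_average_log_thetaNorm hτ hχ hne
  obtain ⟨n₁, hn₁⟩ := Metric.tendsto_atTop.1 h1 η hη0
  obtain ⟨n₂, hn₂⟩ := eventually_atTop.1 (eventually_sum_truncLog_le hχ hHL hη0)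
  refine ⟨max (max n₁ n₂) 1, fun n hn => ?_⟩
  have hn1 := hn₁ n (by omega)
  have hn2 := hn₂ n (by omega)
  have hnp : (0 : ℝ) < n := by exact_mod_cast (show 0 < n by omega)
  set y : ℕ → ℝ := fun m => ((m + 1 : ℕ) : ℝ) * χ - round (((m + 1 : ℕ) : ℝ) * χ) with hy
  have hy0 : ∀ m, y m ≠ 0 := fun m h =>
    (hχ.natCast_mul m.succ_ne_zero).ne_int _ (sub_eq_zero.1 h)
  -- The orbit starts at χω, so its m-th point is (m+1)χω; subtracting an integer multiple of the
  -- lattice vector ω leaves y m · ω. The zero at m + 1 = 0 is never met.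
  have hper : ∀ (m : ℕ) (u : ℂ), thetaNorm τ (χ * ω + u + ((m * χ : ℝ) : ℂ) * ω) =
      thetaNorm τ (u + y m * ω) := by
    intro m u
    rw [← thetaNorm_add_lattice hτ (u + y m * ω) (round (((m + 1 : ℕ) : ℝ) * χ) * N)
      (round (((m + 1 : ℕ) : ℝ) * χ) * M)]
    congr 1
    simp only [hy, hω, latticeVec]
    push_cast
    ring
  have hdiff : |(n : ℝ)⁻¹ * ∑ m ∈ Finset.range n,
      Real.log (thetaNorm τ (χ * ω + v + ((m * χ : ℝ) : ℂ) * ω)) -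
      (n : ℝ)⁻¹ * ∑ m ∈ Finset.range n,
        Real.log (thetaNorm τ (χ * ω + ((m * χ : ℝ) : ℂ) * ω))| ≤ 19 * η := by
    rw [← mul_sub, ← Finset.sum_sub_distrib, abs_mul, abs_of_pos (inv_pos.2 hnp),
      inv_mul_le_iff₀ hnp]
    calc _ ≤ ∑ m ∈ Finset.range n, (2 * η + max 0 (Real.log (η / |y m|))) := by
          refine (Finset.abs_sum_le_sum_abs _ _).trans (Finset.sum_le_sum fun m _ => ?_)
          have e := hper m 0
          rw [add_zero, zero_add] at e
          rw [hper m v, e]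
          exact hbd (y m) (hy0 m) (abs_sub_round _)
      _ ≤ n * (2 * η) + 17 * η * n := by
          rw [Finset.sum_add_distrib, Finset.sum_const, Finset.card_range, nsmul_eq_mul]
          linarith
      _ = n * (19 * η) := by ring
  rw [Real.dist_eq] at hn1 ⊢
  have hpi := Real.pi_lt_four
  have h5 : Real.pi * s ≤ 4 * η := by nlinarith [Real.pi_pos]
  rw [abs_le] at hdiff hmean'
  rw [abs_lt] at hn1 ⊢
  constructor <;> linarith [hdiff.1, hdiff.2, hmean'.1, hmean'.2, hn1.1, hn1.2]

end Average

/-! ### Coefficients of the theta hypergeometric series -/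

section Coefficients

variable {τ : ℂ} {N M : ℤ}

lemma linePoint_eq (x : ℝ) :
    linePoint N M τ x = Complex.exp (2 * Real.pi * Complex.I * (x * latticeVec N M τ)) := by
  rw [linePoint, latticeVec]; congr 1; ring

/-- Up to 2πiℤ, log ū is the conjugate of 2πiv, and Re(-iωv̄) = Im(ωv̄) is the numerator of the
transversal coordinate. -/
lemma phase_exp (hτ : 0 < τ.im) {u v : ℂ} (hu : u = Complex.exp (2 * Real.pi * Complex.I * v)) :
    phase N M τ u = Int.fract (transCoord N M τ v) := by
  have h0 : u ≠ 0 := by rw [hu]; exact Complex.exp_ne_zero _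
  have h1 : Complex.exp (Complex.log (starRingEnd ℂ u)) =
      Complex.exp (starRingEnd ℂ (2 * Real.pi * Complex.I * v)) := by
    rw [Complex.exp_log (by simpa using h0), Complex.exp_conj, ← hu]
  obtain ⟨n, hn⟩ := Complex.exp_eq_exp_iff_exists_int.1 h1
  rw [phase, Int.fract_eq_fract]
  refine ⟨-(n * M), ?_⟩
  rw [hn]
  simp [transCoord, latticeVec]
  have := hτ.ne'
  field_simp
  ring

lemma exists_exp_eq {u : ℂ} (hu : u ≠ 0) : ∃ v, u = Complex.exp (2 * Real.pi * Complex.I * v) := by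
  refine ⟨Complex.log u / (2 * Real.pi * Complex.I), ?_⟩
  rw [mul_div_cancel₀ _ Complex.two_pi_I_ne_zero, Complex.exp_log hu]

/-- If the transversal coordinate were an integer, a lattice translate of v would lie on ℝω, putting
u on the excluded curve. -/
lemma OffLine.fract_transCoord_ne_zero (hτ : 0 < τ.im) (hNM : Int.gcd N M = 1) {u v : ℂ}
    (h : OffLine N M τ u) (hu : u = Complex.exp (2 * Real.pi * Complex.I * v)) :
    Int.fract (transCoord N M τ v) ≠ 0 := by
  intro h0
  obtain ⟨k, hk⟩ := Int.fract_eq_zero_iff.1 h0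
  obtain ⟨a, b, hab⟩ := exists_lattice_transCoord_eq hτ hNM (-k)
  obtain ⟨x, hx⟩ := exists_eq_mul_sub_I_mul hτ hNM (v + (a + b * τ))
  rw [transCoord_add, hab, ← hk] at hx
  simp only [Int.cast_neg, add_neg_cancel, zero_mul, Complex.ofReal_zero, neg_zero,
    add_zero] at hx
  refine h (-b) x ?_
  rw [hu, linePoint_eq, ← hx, nome, ← Complex.exp_int_mul, ← Complex.exp_add,
    Complex.exp_eq_exp_iff_exists_int]
  exact ⟨-a, by push_cast; ring⟩

/-- The factors of modulus growth in `θ(u q^m; p)` not captured by the normalized theta function. -/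
noncomputable def growth (τ : ℂ) (a l : ℝ) (m : ℕ) : ℝ :=
  (a + m * l) ^ 2 / (4 * Real.pi * τ.im) + (a + m * l) / 2

lemma norm_theta_mul_pow (χ : ℝ) {u v : ℂ}
    (hu : u = Complex.exp (2 * Real.pi * Complex.I * v)) (m : ℕ) :
    ‖theta (u * linePoint N M τ χ ^ m) (nome τ)‖ =
      thetaNorm τ (v + ((m * χ : ℝ) : ℂ) * latticeVec N M τ) *
        Real.exp (growth τ (Real.log ‖u‖) (Real.log ‖linePoint N M τ χ‖) m) := by
  have hu0 : u ≠ 0 := by rw [hu]; exact Complex.exp_ne_zero _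
  have hq0 : linePoint N M τ χ ≠ 0 := Complex.exp_ne_zero _
  rw [norm_theta_exp_mul (v + ((m * χ : ℝ) : ℂ) * latticeVec N M τ), growth, norm_mul, norm_pow,
    Real.log_mul (norm_ne_zero_iff.2 hu0) (pow_ne_zero _ (norm_ne_zero_iff.2 hq0)), Real.log_pow]
  rw [hu, linePoint_eq, ← Complex.exp_nat_mul, ← Complex.exp_add]
  congr 1
  push_cast
  ring

lemma thetaPoch_ne_zero_and_log_norm {χ : ℝ} {u v : ℂ}
    (hu : u = Complex.exp (2 * Real.pi * Complex.I * v))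
    (hv : ∀ m : ℕ, thetaLift τ (v + ((m * χ : ℝ) : ℂ) * latticeVec N M τ) ≠ 0) (n : ℕ) :
    thetaPoch u (nome τ) (linePoint N M τ χ) n ≠ 0 ∧
    Real.log ‖thetaPoch u (nome τ) (linePoint N M τ χ) n‖ =
      ∑ m ∈ Finset.range n, Real.log (thetaNorm τ (v + ((m * χ : ℝ) : ℂ) * latticeVec N M τ)) +
        ∑ m ∈ Finset.range n, growth τ (Real.log ‖u‖) (Real.log ‖linePoint N M τ χ‖) m := by
  have hpos : ∀ m : ℕ, 0 < thetaNorm τ (v + ((m * χ : ℝ) : ℂ) * latticeVec N M τ) := fun m =>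
    (thetaNorm_pos_iff _).2 (hv m)
  have hne : ∀ m : ℕ, ‖theta (u * linePoint N M τ χ ^ m) (nome τ)‖ ≠ 0 := fun m => by
    rw [norm_theta_mul_pow χ hu]
    exact mul_ne_zero (hpos m).ne' (Real.exp_ne_zero _)
  refine ⟨Finset.prod_ne_zero_iff.2 fun m _ => norm_ne_zero_iff.1 (hne m), ?_⟩
  rw [thetaPoch, norm_prod, Real.log_prod (fun m _ => hne m), ← Finset.sum_add_distrib]
  refine Finset.sum_congr rfl fun m _ => ?_
  rw [norm_theta_mul_pow χ hu, Real.log_mul (hpos m).ne' (Real.exp_ne_zero _), Real.log_exp]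

/-- The growth of `θ(u; p; q)_n` when `u` is off the line, or `u = q`. -/
lemma exists_tendsto_log_norm_thetaPoch (hτ : 0 < τ.im) (hNM : Int.gcd N M = 1) {χ : ℝ}
    (hχ : Irrational χ) (hHL : HardyLittlewood χ) :
    ∃ c₀ : ℝ, ∀ u : ℂ, (u ≠ 0 ∧ OffLine N M τ u) ∨ u = linePoint N M τ χ →
      (∀ n, thetaPoch u (nome τ) (linePoint N M τ χ) n ≠ 0) ∧
      Tendsto (fun n : ℕ => (n : ℝ)⁻¹ *
        (Real.log ‖thetaPoch u (nome τ) (linePoint N M τ χ) n‖ -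
          ∑ m ∈ Finset.range n, growth τ (Real.log ‖u‖) (Real.log ‖linePoint N M τ χ‖) m)) atTop
        (𝓝 (c₀ - Real.pi * τ.im / ‖latticeVec N M τ‖ ^ 2 *
          (phase N M τ u * (phase N M τ u - 1)))) := by
  obtain ⟨c₀, hc₀⟩ := exists_meanLog_eq hτ hNM
  refine ⟨c₀, fun u hu => ?_⟩
  obtain ⟨v, huv, hne, hlim⟩ : ∃ v, u = Complex.exp (2 * Real.pi * Complex.I * v) ∧
      (∀ m : ℕ, thetaLift τ (v + ((m * χ : ℝ) : ℂ) * latticeVec N M τ) ≠ 0) ∧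
      Tendsto (fun n : ℕ => (n : ℝ)⁻¹ * ∑ m ∈ Finset.range n,
        Real.log (thetaNorm τ (v + ((m * χ : ℝ) : ℂ) * latticeVec N M τ))) atTop
        (𝓝 (c₀ - Real.pi * τ.im / ‖latticeVec N M τ‖ ^ 2 *
          (phase N M τ u * (phase N M τ u - 1)))) := by
    rcases hu with ⟨hu0, hu⟩ | hu
    · obtain ⟨v, hv⟩ := exists_exp_eq hu0
      have hfr := hu.fract_transCoord_ne_zero hτ hNM hv
      refine ⟨v, hv, fun m => thetaLift_ne_zero_of_fract_ne_zero hτ hfr _, ?_⟩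
      rw [phase_exp hτ hv, ← hc₀ v hfr]
      exact tendsto_average_log_thetaNorm hτ hχ hfr
    · rw [linePoint_eq] at hu
      refine ⟨_, hu, fun m h => ?_, ?_⟩
      · rw [← add_mul, ← Complex.ofReal_add] at h
        obtain ⟨k, hk⟩ := exists_int_of_thetaLift_eq_zero hτ hNM h
        refine (hχ.natCast_mul m.succ_ne_zero).ne_int k ?_
        rw [← hk]; push_cast; ring
      -- The phase of q is 0, so its limit c₀ fits the same formula as the off-line parameters.
      · rw [phase_exp hτ hu, transCoord_ofReal_mul, Int.fract_zero, zero_mul, mul_zero, sub_zero]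
        exact tendsto_average_log_thetaNorm_singular hτ hNM hχ hHL hc₀
  have h := thetaPoch_ne_zero_and_log_norm huv hne
  refine ⟨fun n => (h n).1, hlim.congr fun n => ?_⟩
  rw [(h n).2, add_sub_cancel_right]

lemma coeffE_eq_prod_div {r : ℕ} (t : Fin (r + 1) → ℂ) (w : Fin r → ℂ) (q p : ℂ) (n : ℕ) :
    coeffE t w q p n = (∏ j, thetaPoch (t j) p q n) /
      ∏ j, thetaPoch ((Fin.cons q w : Fin (r + 1) → ℂ) j) p q n := by
  rw [coeffE, Fin.prod_univ_succ (fun j => thetaPoch ((Fin.cons q w : Fin (r + 1) → ℂ) j) p q n)]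
  simp

/-- In a difference of growth terms, m occurs only in a multiple of a j - b j with coefficient
independent of j; the balancing hypothesis kills that part. -/
lemma sum_growth_sub {r : ℕ} (a b : Fin r → ℝ) (l : ℝ) (h : ∑ j, a j = ∑ j, b j) (n : ℕ) :
    ∑ j, (∑ m ∈ Finset.range n, growth τ (a j) l m - ∑ m ∈ Finset.range n, growth τ (b j) l m) =
      n * ∑ j, (a j ^ 2 - b j ^ 2) / (4 * Real.pi * τ.im) := by
  simp_rw [← Finset.sum_sub_distrib]
  rw [Finset.sum_comm]
  have h1 : ∀ m ∈ Finset.range n, ∑ j, (growth τ (a j) l m - growth τ (b j) l m) =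
      ∑ j, (a j ^ 2 - b j ^ 2) / (4 * Real.pi * τ.im) := by
    intro m _
    have h2 : ∀ j, growth τ (a j) l m - growth τ (b j) l m =
        (a j ^ 2 - b j ^ 2) / (4 * Real.pi * τ.im) +
          (2 * m * l / (4 * Real.pi * τ.im) + 1 / 2) * (a j - b j) := fun j => by
      simp only [growth]; ring
    simp_rw [h2]
    rw [Finset.sum_add_distrib, ← Finset.mul_sum, Finset.sum_sub_distrib, h, sub_self, mul_zero,
      add_zero]
  rw [Finset.sum_congr rfl h1, Finset.sum_const, Finset.card_range, nsmul_eq_mul]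

/-- Prepending q to the w's pairs each t with one denominator parameter, so c₀ cancels in every
pair; taking norms in the product relation gives the balance needed by `sum_growth_sub`. -/
lemma tendsto_log_norm_coeffE (hτ : 0 < τ.im) (hNM : Int.gcd N M = 1) {χ : ℝ}
    (hχ : Irrational χ) (hHL : HardyLittlewood χ) {r : ℕ} (t : Fin (r + 1) → ℂ) (w : Fin r → ℂ)
    (ht : ∀ j, t j ≠ 0) (hw : ∀ k, w k ≠ 0)
    (hprod : ∏ j, t j = linePoint N M τ χ * ∏ k, w k)
    (hto : ∀ j, OffLine N M τ (t j)) (hwo : ∀ k, OffLine N M τ (w k)) :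
    (∀ n, coeffE t w (linePoint N M τ χ) (nome τ) n ≠ 0) ∧
    Tendsto (fun n : ℕ => (n : ℝ)⁻¹ *
      Real.log ‖coeffE t w (linePoint N M τ χ) (nome τ) n‖) atTop
      (𝓝 (logInvRadius N M τ t (Fin.cons (linePoint N M τ χ) w : Fin (r + 1) → ℂ))) := by
  obtain ⟨c₀, hc₀⟩ := exists_tendsto_log_norm_thetaPoch hτ hNM hχ hHL
  set q := linePoint N M τ χ with hq
  have hq0 : q ≠ 0 := Complex.exp_ne_zero _
  set w' : Fin (r + 1) → ℂ := Fin.cons q w with hw'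
  have hT := fun j => hc₀ (t j) (Or.inl ⟨ht j, hto j⟩)
  have hW := fun j => hc₀ (w' j) (by
    refine Fin.cases (Or.inr rfl) (fun k => Or.inl ?_) j
    simpa [hw'] using ⟨hw k, hwo k⟩)
  have hw'0 : ∀ j, w' j ≠ 0 := fun j => Fin.cases hq0 (fun k => by simpa [hw'] using hw k) j
  have hne : ∀ n, coeffE t w q (nome τ) n ≠ 0 := fun n => by
    rw [coeffE_eq_prod_div]
    exact div_ne_zero (Finset.prod_ne_zero_iff.2 fun j _ => (hT j).1 n)
      (Finset.prod_ne_zero_iff.2 fun j _ => (hW j).1 n)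
  refine ⟨hne, ?_⟩
  have hbal : ∑ j, Real.log ‖t j‖ = ∑ j, Real.log ‖w' j‖ := by
    rw [← Real.log_prod fun j _ => norm_ne_zero_iff.2 (ht j),
      ← Real.log_prod fun j _ => norm_ne_zero_iff.2 (hw'0 j), ← norm_prod, ← norm_prod, hprod,
      Fin.prod_univ_succ w']
    simp [hw']
  have hlog : ∀ n, Real.log ‖coeffE t w q (nome τ) n‖ =
      ∑ j, (Real.log ‖thetaPoch (t j) (nome τ) q n‖ - Real.log ‖thetaPoch (w' j) (nome τ) q n‖) := by
    intro n
    rw [coeffE_eq_prod_div, norm_div, norm_prod, norm_prod, Real.log_div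
      (Finset.prod_ne_zero_iff.2 fun j _ => norm_ne_zero_iff.2 ((hT j).1 n))
      (Finset.prod_ne_zero_iff.2 fun j _ => norm_ne_zero_iff.2 ((hW j).1 n)),
      Real.log_prod fun j _ => norm_ne_zero_iff.2 ((hT j).1 n),
      Real.log_prod fun j _ => norm_ne_zero_iff.2 ((hW j).1 n), Finset.sum_sub_distrib]
  have hlim := (tendsto_finsetSum Finset.univ fun j _ => (hT j).2.sub (hW j).2).add_const
    (∑ j, (Real.log ‖t j‖ ^ 2 - Real.log ‖w' j‖ ^ 2) / (4 * Real.pi * τ.im))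
  convert! hlim.congr' ?_ using 2
  · rw [logInvRadius, ← Finset.sum_add_distrib]
    refine Finset.sum_congr rfl fun j _ => ?_
    rw [latticeVec]
    ring
  · filter_upwards [eventually_ne_atTop 0] with n hn
    have hn' : (n : ℝ) ≠ 0 := by exact_mod_cast hn
    have h1 := sum_growth_sub (τ := τ) (fun j => Real.log ‖t j‖) (fun j => Real.log ‖w' j‖)
      (Real.log ‖q‖) hbal n
    rw [hlog]
    have h2 : ∑ j, (Real.log ‖t j‖ ^ 2 - Real.log ‖w' j‖ ^ 2) / (4 * Real.pi * τ.im) =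
        (n : ℝ)⁻¹ * (n * ∑ j, (Real.log ‖t j‖ ^ 2 - Real.log ‖w' j‖ ^ 2) / (4 * Real.pi * τ.im)) := by
      rw [inv_mul_cancel_left₀ hn']
    rw [h2, ← h1]
    simp_rw [← mul_sub]
    rw [← Finset.mul_sum, ← mul_add, ← Finset.sum_add_distrib]
    congr 1
    refine Finset.sum_congr rfl fun j _ => ?_
    ring

/-- The root test for the radius of convergence of a power series in one variable. -/
lemma radius_ofScalars_eq_of_tendsto {c : ℕ → ℂ} {L : ℝ}
    (h : Tendsto (fun n : ℕ => ‖c n‖ ^ (1 / (n : ℝ))) atTop (𝓝 (Real.exp L))) :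
    (FormalMultilinearSeries.ofScalars ℂ c).radius = ENNReal.ofReal (Real.exp (-L)) := by
  have h1 := (ENNReal.tendsto_ofReal h).inv
  rw [FormalMultilinearSeries.radius_eq_liminf]
  rw [Real.exp_neg, ENNReal.ofReal_inv_of_pos (Real.exp_pos _)]
  refine Tendsto.liminf_eq (h1.congr fun n => ?_)
  have h2 : ‖c n‖ ^ (1 / (n : ℝ)) =
      ((‖FormalMultilinearSeries.ofScalars ℂ c n‖₊ ^ (1 / (n : ℝ)) : NNReal) : ℝ) := by
    rw [NNReal.coe_rpow, coe_nnnorm, FormalMultilinearSeries.ofScalars_norm]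
  rw [h2, ENNReal.ofReal_coe_nnreal, one_div, one_div]

end Coefficients

end EllipticHypergeometric

open EllipticHypergeometric in
theorem mainTheorem2 :
    (∀ᵐ χ : ℝ, Irrational χ ∧ HardyLittlewood χ) ∧
    ∀ (r : ℕ) (τ : ℂ) (_ : 0 < τ.im) (N M : ℤ) (_ : Int.gcd N M = 1)
      (χ : ℝ) (_ : Irrational χ) (_ : HardyLittlewood χ)
      (p q : ℂ) (_ : p = nome τ) (_ : q = linePoint N M τ χ)
      (t : Fin (r + 1) → ℂ) (w : Fin r → ℂ)
      (_ : ∀ j, t j ≠ 0) (_ : ∀ k, w k ≠ 0)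
      (_ : ∏ j, t j = q * ∏ k, w k)
      (_ : ∀ j, OffLine N M τ (t j)) (_ : ∀ k, OffLine N M τ (w k)),
      Tendsto (fun n : ℕ => ‖coeffE t w q p n‖ ^ (1 / (n : ℝ))) atTop
        (𝓝 (Real.exp (logInvRadius N M τ t (Fin.cons q w : Fin (r + 1) → ℂ)))) ∧
      (seriesE t w q p).radius =
        ENNReal.ofReal
          (Real.exp (-logInvRadius N M τ t (Fin.cons q w : Fin (r + 1) → ℂ))) := by
  refine ⟨ae_irrational_hardyLittlewood, ?_⟩
  rintro r τ hτ N M hNM χ hχ hHL p q rfl rfl t w ht hw hprod hto hwo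
  obtain ⟨hne, hlim⟩ := tendsto_log_norm_coeffE hτ hNM hχ hHL t w ht hw hprod hto hwo
  have hroot : Tendsto (fun n : ℕ => ‖coeffE t w (linePoint N M τ χ) (nome τ) n‖ ^ (1 / (n : ℝ)))
      atTop (𝓝 (Real.exp (logInvRadius N M τ t
        (Fin.cons (linePoint N M τ χ) w : Fin (r + 1) → ℂ)))) := by
    refine ((Real.continuous_exp.tendsto _).comp hlim).congr fun n => ?_
    rw [Function.comp_apply, Real.rpow_def_of_pos (norm_pos_iff.2 (hne n)), one_div, mul_comm]
  exact ⟨hroot, radius_ofScalars_eq_of_tendsto hroot⟩
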